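/- Setting. Let $\mathcal X$ be a Polish space, $\mathcal Y$ a separable (real or complex) Hilbert space, $\rho$ a Borel probability measure on $\mathcal X\times\mathcal Y$ whose marginal $\rho_{\mathcal X}$ has full support, and $L^2:=L^2(\mathcal X,\rho_{\mathcal X};\mathcal Y)$ with norm $\|\cdot\|_{\rho_{\mathcal X}}$. Put $\mathcal E(h):=\mathbb E_{(x,y)\sim\rho}\|h(x)-y\|_{\mathcal Y}^2$ and $h^\dagger(x):=\int_{\mathcal Y}y\,\mathrm d\rho(y|x)$. Let $K:\mathcal X\times\mathcal X\to\mathcal B(\mathcal Y)$ be a positive semi-definite Hermitian operator-valued kernel with reproducing kernel Hilbert space $(\mathcal H_K,\|\cdot\|_K)$, such that all elements of $\mathcal H_K$ are continuous (Mercer kernel) and $\sup_x\|K(x,x)\|\le\kappa^2$. Let $L_K$ be the (positive, bounded, possibly non-compact) integral operator $(L_Kh)(x)=\int_{\mathcal X} K(x,t)h(t)\,\mathrm d\rho_{\mathcal X}(t)$ on $L^2$. Let $z_t=(x_t,y_t)$, $t\ge1$, be i.i.d. with law $\rho$, let $\mathbb E_{z^T}$ be the expectation over $z_1,\dots,z_T$,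 and for step sizes $\eta_t>0$ let $h_1:=0$ and $h_{t+1}:=h_t-\eta_tK(\cdot,x_t)\bigl(h_t(x_t)-y_t\bigr)$. For $0<\theta<1$ let $\delta=\delta(\theta)$ be the least constant such that, for all $T\ge2$ and $\eta_1>0$, the steps $\eta_t=\eta_1t^{-\theta}$ satisfy $$\sum_{t=1}^{T-1}\frac{\eta_t^2}{1+\sum_{j=t+1}^T\eta_j}\le\delta\,\frac{\eta_1^2}{\min\{1,\frac{\eta_1}{1-\theta}\}}\begin{cases}(T+1)^{-\theta}\log(T+1),&0<\theta\le\frac12,\\(T+1)^{-(1-\theta)},&\frac12<\theta<1,\end{cases}$$ and put $$\gamma_1:=\frac{\theta}{4\kappa^2(1+2\kappa^2)(\delta+1)},\qquad \gamma_1':=\frac{\theta'}{4\kappa^2(1+2\kappa^2)(1+2\theta')}$$ (with $1/0=\infty$ here and in $\|L_K\|^{-1}$). Theorem. Assume that $\mathbb E_{(x,y)\sim\rho}\|y-h^\dagger(x)\|_{\mathcal Y}^2\le\sigma^2$ with $\sigma^2>0$, and that $h^\dagger=L_K^rg^\dagger$ with $r>0$ and $g^\dagger\in L^2$. Let $T\ge1$.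 (1) Let $0<\theta<1$ and $\eta_t=\eta_1t^{-\theta}$ with $0<\eta_1<\min\{\|L_K\|^{-1},1-\theta,\gamma_1\}$. Then, with $m:=\min\{2r,1\}$, $$\mathbb E_{z^T}\bigl[\mathcal E(h_{T+1})-\mathcal E(h^\dagger)\bigr]\le c_1\eta_1^{-2r}\begin{cases}(T+1)^{-\theta}\log(T+1),&0<\theta\le\frac{m}{1+m},\\(T+1)^{-m(1-\theta)},&\frac{m}{1+m}<\theta<1.\end{cases}$$ (2) Let $0<\theta'<1$ and let the step sizes be constant, $\eta_t=\eta T^{-\theta'}$ for $1\le t\le T$, with $0<\eta<\min\{\|L_K\|^{-1},1,\gamma_1'\}$. Then $$\mathbb E_{z^T}\bigl[\mathcal E(h_{T+1})-\mathcal E(h^\dagger)\bigr]\le c_1'\eta^{-2r}\begin{cases}(T+1)^{-\theta'}\log(T+1),&0<\theta'\le\frac{2r}{1+2r},\\(T+1)^{-2r(1-\theta')},&\frac{2r}{1+2r}<\theta'<1,\end{cases}$$ and if moreover $r>\frac12$ and $\frac12<\theta'<1$, then $h^\dagger\in\mathcal H_K$ (up to $\rho_{\mathcal X}$-null sets) and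 $$\mathbb E_{z^T}\|h_{T+1}-h^\dagger\|_K^2\le c_1'\eta^{-(2r-1)}\begin{cases}(T+1)^{1-2\theta'},&\frac12<\theta'\le\frac{2r}{2r+1},\\(T+1)^{-(2r-1)(1-\theta')},&\frac{2r}{2r+1}<\theta'<1.\end{cases}$$ Here $c_1$ and $c_1'$ are independent of $T$, $\eta_1$ and $\eta$. -/

import Mathlib

open MeasureTheory Filter Topology
open scoped ENNReal NNReal

noncomputable section

namespace KernelSGD

lemma inner_kernel_apply {𝕜 : Type*} [RCLike 𝕜] {X : Type*} {Y : Type*} [NormedAddCommGroup Y]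
    [InnerProductSpace 𝕜 Y] [CompleteSpace Y] {K : Matrix X X (Y →L[𝕜] Y)} [Fact K.PosSemidef]
    (x t : X) (y v : Y) :
    inner 𝕜 y (K x t v) = inner 𝕜 ((RKHS.kerFun (RKHS.OfKernel K) x y : RKHS.OfKernel K) t) v := by
  have h1 : K x t v = (RKHS.kerFun (RKHS.OfKernel K) t v : RKHS.OfKernel K) x := by
    rw [RKHS.kerFun_apply, RKHS.OfKernel.kernel_ofKernel]
  rw [h1, ← RKHS.kerFun_inner, RKHS.inner_kerFun]

section Kernel

variable {𝕜 : Type*} [RCLike 𝕜] {X : Type*} [TopologicalSpace X]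
  {Y : Type*} [NormedAddCommGroup Y] [InnerProductSpace 𝕜 Y] [CompleteSpace Y]

/-- `K` is a Mercer kernel (every function of its reproducing kernel Hilbert space
`RKHS.OfKernel K` is continuous) and `sup_x ‖K(x, x)‖ ≤ κ ^ 2`. -/
structure IsBoundedMercer (K : Matrix X X (Y →L[𝕜] Y)) [Fact K.PosSemidef] (κ : ℝ) : Prop where
  continuous_mem : ∀ f : RKHS.OfKernel K, Continuous (f : X → Y)
  norm_diag_le : ∀ x, ‖K x x‖ ≤ κ ^ 2

/-- The iterates of kernel stochastic gradient descent for the step sizes `η 1, η 2, …` and the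
observations `z 1, z 2, …`, where `z t = (x_t, y_t)`.  `iterate K η z n` is `h_{n+1}`, the iterate
after `n` steps: `h_1 = 0` and `h_{t+1} = h_t - η_t K(·, x_t) (h_t(x_t) - y_t)`.
Here `RKHS.kerFun _ x y` is the element `K(·, x) y` of the RKHS. -/
def iterate (K : Matrix X X (Y →L[𝕜] Y)) [Fact K.PosSemidef] (η : ℕ → ℝ) (z : ℕ → X × Y) :
    ℕ → RKHS.OfKernel K
  | 0 => 0
  | n + 1 =>
      iterate K η z n - (η (n + 1) : 𝕜) •
        RKHS.kerFun (RKHS.OfKernel K) (z (n + 1)).1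
          (iterate K η z n (z (n + 1)).1 - (z (n + 1)).2)

lemma IsBoundedMercer.norm_apply_le {K : Matrix X X (Y →L[𝕜] Y)} [Fact K.PosSemidef] {κ : ℝ}
    (hK : IsBoundedMercer K κ) (f : RKHS.OfKernel K) (x : X) :
    ‖f x‖ ≤ |κ| * ‖f‖ := by
  have h := RKHS.norm_apply_le f x
  rw [RKHS.OfKernel.kernel_ofKernel] at h
  have h2 : √‖K x x‖ ≤ |κ| := by
    rw [← Real.sqrt_sq_eq_abs]
    exact Real.sqrt_le_sqrt (hK.norm_diag_le x)
  calc ‖f x‖ ≤ ‖f‖ * √‖K x x‖ := h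
    _ ≤ ‖f‖ * |κ| := by gcongr
    _ = _ := mul_comm _ _

lemma IsBoundedMercer.norm_le {K : Matrix X X (Y →L[𝕜] Y)} [Fact K.PosSemidef] {κ : ℝ}
    (hK : IsBoundedMercer K κ) (x t : X) : ‖K x t‖ ≤ κ ^ 2 := by
  have h := RKHS.norm_kernel_sq_le (RKHS.OfKernel K) x t
  rw [RKHS.OfKernel.kernel_ofKernel] at h
  have h1 := hK.norm_diag_le x
  have h2 := hK.norm_diag_le t
  have h3 : ‖K x t‖ ^ 2 ≤ (κ ^ 2) ^ 2 := by
    calc ‖K x t‖ ^ 2 ≤ ‖K x x‖ * ‖K t t‖ := h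
      _ ≤ κ ^ 2 * κ ^ 2 := by gcongr
      _ = _ := by ring
  exact le_of_sq_le_sq h3 (sq_nonneg κ)

end Kernel

section Operator

variable {𝕜 : Type*} [RCLike 𝕜] {X : Type*} [TopologicalSpace X]
  [MeasurableSpace X] [BorelSpace X]
  {Y : Type*} [NormedAddCommGroup Y] [InnerProductSpace 𝕜 Y] [CompleteSpace Y]
  [SecondCountableTopology Y]
  {K : Matrix X X (Y →L[𝕜] Y)} [Fact K.PosSemidef] {κ : ℝ}

lemma IsBoundedMercer.memLp (hK : IsBoundedMercer K κ) (μ : Measure X) [IsFiniteMeasure μ]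
    (f : RKHS.OfKernel K) : MemLp (f : X → Y) 2 μ :=
  MemLp.of_bound (hK.continuous_mem f).aestronglyMeasurable (|κ| * ‖f‖)
    (Eventually.of_forall (hK.norm_apply_le f))

/-- The canonical embedding `ι_K` of the RKHS into `L²(μ; Y)`. -/
def inclusion (hK : IsBoundedMercer K κ) (μ : Measure X) [IsFiniteMeasure μ] :
    RKHS.OfKernel K →L[𝕜] Lp Y 2 μ :=
  LinearMap.mkContinuous
    { toFun := fun f => (hK.memLp μ f).toLp (f : X → Y)
      map_add' := fun f g => by
        rw [← MemLp.toLp_add]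
        exact MemLp.toLp_congr _ _ (by rw [RKHS.coe_add])
      map_smul' := fun c f => by
        rw [RingHom.id_apply, ← MemLp.toLp_const_smul]
        exact MemLp.toLp_congr _ _ (by rw [RKHS.coe_smul]) }
    (measureUnivNNReal μ ^ (2 : ℝ≥0∞).toReal⁻¹ * |κ|)
    (fun f => by
      rw [mul_assoc]
      refine Lp.norm_le_of_ae_bound (by positivity) ?_
      filter_upwards [(hK.memLp μ f).coeFn_toLp] with x hx
      change ‖((hK.memLp μ f).toLp (f : X → Y)) x‖ ≤ _
      rw [hx]
      exact hK.norm_apply_le f x)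

lemma coeFn_inclusion (hK : IsBoundedMercer K κ) (μ : Measure X) [IsFiniteMeasure μ]
    (f : RKHS.OfKernel K) : inclusion hK μ f =ᵐ[μ] (f : X → Y) :=
  (hK.memLp μ f).coeFn_toLp

/-- A function into a separable Hilbert space all of whose inner products are strongly measurable
is strongly measurable. -/
lemma stronglyMeasurable_of_inner {α : Type*} [MeasurableSpace α] {f : α → Y}
    (hf : ∀ y : Y, StronglyMeasurable fun t => inner 𝕜 y (f t)) : StronglyMeasurable f := by
  obtain ⟨w, b, hb⟩ := exists_hilbertBasis 𝕜 Y
  have hc : Countable w := by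
    have ho : Orthonormal 𝕜 (fun i : w => (i : Y)) := by
      have := b.orthonormal
      rwa [hb] at this
    refine Pairwise.countable_of_isOpen_disjoint
      (s := fun i : w => Metric.ball (i : Y) (1 / 2)) ?_ (fun i => Metric.isOpen_ball)
      (fun i => ⟨i, Metric.mem_ball_self (by norm_num)⟩)
    intro i j hij
    refine Metric.ball_disjoint_ball ?_
    have h0 : inner 𝕜 (i : Y) (j : Y) = 0 := ho.2 hij
    have h1 : ‖(i : Y) - j‖ * ‖(i : Y) - j‖ = ‖(i : Y)‖ * ‖(i : Y)‖ + ‖(j : Y)‖ * ‖(j : Y)‖ := by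
      have := norm_sub_mul_self (𝕜 := 𝕜) (i : Y) (j : Y)
      rw [h0] at this
      simpa using this
    have e1 : ‖(i : Y)‖ = 1 := ho.1 i
    have e2 : ‖(j : Y)‖ = 1 := ho.1 j
    rw [e1, e2] at h1
    rw [dist_eq_norm]
    nlinarith [norm_nonneg ((i : Y) - j)]
  refine stronglyMeasurable_of_tendsto (atTop : Filter (Finset w))
    (f := fun s t => ∑ i ∈ s, b.repr (f t) i • b i) (fun s => ?_) ?_
  · refine Finset.stronglyMeasurable_fun_sum s fun i _ => ?_
    refine StronglyMeasurable.smul_const ?_ _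
    simp_rw [b.repr_apply_apply]
    exact hf (b i)
  · rw [tendsto_pi_nhds]
    exact fun t => b.hasSum_repr (f t)

lemma IsBoundedMercer.integrable (hK : IsBoundedMercer K κ) (μ : Measure X) [IsFiniteMeasure μ]
    (h : Lp Y 2 μ) (x : X) : Integrable (fun t => K x t (h t)) μ := by
  have hmeas : StronglyMeasurable (fun t => K x t (h t)) := by
    refine stronglyMeasurable_of_inner (𝕜 := 𝕜) fun y => ?_
    simp_rw [inner_kernel_apply]
    exact (hK.continuous_mem _).stronglyMeasurable.inner (Lp.stronglyMeasurable h)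
  have hh : Integrable (h : X → Y) μ := (Lp.memLp h).integrable (by norm_num)
  refine (hh.norm.const_mul (κ ^ 2)).mono' hmeas.aestronglyMeasurable
    (Eventually.of_forall fun t => ?_)
  calc ‖K x t (h t)‖ ≤ ‖K x t‖ * ‖h t‖ := (K x t).le_opNorm _
    _ ≤ κ ^ 2 * ‖h t‖ := by gcongr; exact hK.norm_le x t

variable [NormedSpace ℝ Y]

lemma adjoint_inclusion_apply (hK : IsBoundedMercer K κ) (μ : Measure X) [IsFiniteMeasure μ]
    (h : Lp Y 2 μ) (x : X) :
    ((inclusion hK μ).adjoint h : RKHS.OfKernel K) x = ∫ t, K x t (h t) ∂μ := by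
  refine ext_inner_left 𝕜 fun y => ?_
  rw [← RKHS.kerFun_inner, ContinuousLinearMap.adjoint_inner_right, L2.inner_def,
    ← integral_inner (hK.integrable μ h x)]
  refine integral_congr_ae ?_
  filter_upwards [coeFn_inclusion hK μ (RKHS.kerFun (RKHS.OfKernel K) x y)] with t ht
  rw [ht, inner_kernel_apply]

lemma IsBoundedMercer.memLp_integral (hK : IsBoundedMercer K κ) (μ : Measure X)
    [IsFiniteMeasure μ] (h : Lp Y 2 μ) : MemLp (fun x => ∫ t, K x t (h t) ∂μ) 2 μ := by
  simp_rw [← adjoint_inclusion_apply hK μ h]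
  exact hK.memLp μ _

lemma toLp_integral_eq (hK : IsBoundedMercer K κ) (μ : Measure X) [IsFiniteMeasure μ] :
    (fun h : Lp Y 2 μ => (hK.memLp_integral μ h).toLp (fun x => ∫ t, K x t (h t) ∂μ)) =
      ⇑(inclusion hK μ ∘L (inclusion hK μ).adjoint) := by
  funext h
  exact MemLp.toLp_congr (hK.memLp_integral μ h) (hK.memLp μ ((inclusion hK μ).adjoint h))
    (Eventually.of_forall fun x => (adjoint_inclusion_apply hK μ h x).symm)

/-- The integral operator `(L_K h)(x) = ∫ K(x, t) h(t) dμ(t)` on `L²(μ; Y)`. -/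
def integralOperator (hK : IsBoundedMercer K κ) (μ : Measure X) [IsFiniteMeasure μ] :
    Lp Y 2 μ →L[𝕜] Lp Y 2 μ :=
  (inclusion hK μ ∘L (inclusion hK μ).adjoint).copy
    (fun h => (hK.memLp_integral μ h).toLp (fun x => ∫ t, K x t (h t) ∂μ))
    (toLp_integral_eq hK μ)

end Operator

section Power

variable {𝕜 : Type*} [RCLike 𝕜] {H : Type*} [NormedAddCommGroup H] [InnerProductSpace 𝕜 H]

/-- `B = A ^ r` in the continuous functional calculus of a positive bounded operator `A` with
`r > 0`: `B` is the norm limit of `p n (A)` for real polynomials `p n` that converge to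
`x ↦ x ^ r` uniformly on `[0, ‖A‖]`, an interval that contains the spectrum of `A`. -/
def IsOpPow (A : H →L[𝕜] H) (r : ℝ) (B : H →L[𝕜] H) : Prop :=
  ∃ p : ℕ → Polynomial ℝ,
    TendstoUniformlyOn (fun n x => (p n).eval x) (fun x : ℝ => x ^ r) atTop (Set.Icc 0 ‖A‖) ∧
    Tendsto (fun n => Polynomial.aeval A ((p n).map (algebraMap ℝ 𝕜))) atTop (𝓝 B)

open Classical in
/-- The power `A ^ r` of a positive bounded operator `A`, for `r > 0`. -/
def opPow (A : H →L[𝕜] H) (r : ℝ) : H →L[𝕜] H :=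
  if h : ∃ B, IsOpPow A r B then h.choose else 0

end Power

section Risk

variable {X : Type*} [MeasurableSpace X]
  {Y : Type*} [NormedAddCommGroup Y] [MeasurableSpace Y]

/-- The expected risk `ℰ(h) = 𝔼 ‖h(x) - y‖²` for `(x, y) ∼ ρ`. -/
def risk (ρ : Measure (X × Y)) (h : X → Y) : ℝ := ∫ z, ‖h z.1 - z.2‖ ^ 2 ∂ρ

/-- The regression operator `h†(x) = ∫ y dρ(y | x)`. -/
def regression [NormedSpace ℝ Y] [StandardBorelSpace Y] (ρ : Measure (X × Y))
    [IsFiniteMeasure ρ] (x : X) : Y :=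
  ∫ y, y ∂(ρ.condKernel x)

end Risk

section StepSizes

/-- `δ` is an admissible constant in the sum estimate for the step sizes `η_t = η₁ t ^ (-θ)`,
uniformly in `T ≥ 2` and in `η₁ > 0`:
`∑_{t=1}^{T-1} η_t² / (1 + ∑_{j=t+1}^T η_j) ≤ δ (η₁² / min {1, η₁ / (1-θ)}) a_T`, where `a_T` is
`(T+1)^{-θ} log (T+1)` for `θ ≤ 1/2` and `(T+1)^{-(1-θ)}` for `θ > 1/2`. -/
def IsStepSumConst (θ δ : ℝ) : Prop :=
  ∀ T : ℕ, 2 ≤ T → ∀ η₁ : ℝ, 0 < η₁ →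
    ∑ t ∈ Finset.Ico 1 T, (η₁ * (t : ℝ) ^ (-θ)) ^ 2 /
        (1 + ∑ j ∈ Finset.Icc (t + 1) T, η₁ * (j : ℝ) ^ (-θ)) ≤
      δ * (η₁ ^ 2 / min 1 (η₁ / (1 - θ))) *
        (if θ ≤ 1 / 2 then ((T : ℝ) + 1) ^ (-θ) * Real.log ((T : ℝ) + 1)
          else ((T : ℝ) + 1) ^ (-(1 - θ)))

/-- The constant `δ = δ(θ)`: the least admissible constant in the sum estimate. -/
def stepSumConst (θ : ℝ) : ℝ := sInf {δ : ℝ | IsStepSumConst θ δ}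

end StepSizes

end KernelSGD

end

/-!
# Convergence rates of kernel stochastic gradient descent

Let `ι` be the inclusion of the reproducing kernel Hilbert space into `L²`, so that `L_K = ι ι*`,
and let `e_n = ι h_{n+1} - h†`.  The stochastic gradient `K(·, x) (h(x) - y)` has mean
`ι* (ι h - h†)`, because the noise `y - h†(x)` is orthogonal to all square integrable functions of
`x` (`integral_inner_noise`, `integral_inner_kerFun`).  Hence one step acts on the error as
`1 - η L_K` plus a centred perturbation, and the mean square error after `T` steps is at most
`‖∏ (1 - η_j L_K) h†‖² + ∑_t η_t² ‖∏_{j>t} (1 - η_j L_K) ι‖² κ² (𝔼 ‖e_{t-1}‖² + σ²)`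
(`integral_iterate_le`).  Independence of the next observation enters through the resampling
identity `integral_infinitePi_eval`.

The operator norms are spectral suprema: `‖p(A)‖ ≤ sup |p|` over `[0, ‖A‖]` for a positive operator
`A` and a real polynomial `p`.  Over a real or complex Hilbert space this follows from the finite
dimensional spectral theorem, by compressing `A` to a Krylov subspace (`re_inner_polyCalc_nonneg`).
It gives the existence of the fractional power `L_K ^ r`, the bias bound
`t ^ r ∏ (1 - η_j t) ≤ (r / ∑ η_j) ^ r`, and the variance bound
`t ∏ (1 - η_j t)² ≤ (1 + κ²) / (1 + ∑ η_j)`.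

The remaining noise sums `∑_t η_t² / (1 + ∑_{j>t} η_j)` are estimated through partial fractions.
The step size conditions make them so small that the errors `𝔼 ‖e_t‖²` stay bounded uniformly in
`t`, `T` and the step sizes (`meanSqError_le_of_noiseSum_le`); inserting this bound into the
decomposition yields the rates.

For the error in the reproducing kernel Hilbert space, `r > 1/2` provides `u` with `ι u = h†`
(`exists_preimage_opPow`), and the same decomposition applies to `h_n - u` with `ι* ι` in place of
`L_K`.
-/

open MeasureTheory Filter Topology
open scoped ENNReal NNReal

noncomputable section

namespace KernelSGD

/-! ### The polynomial calculus of a positive operator -/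

section PolynomialCalculus

open Polynomial

variable {𝕜 : Type*} [RCLike 𝕜] {H : Type*} [NormedAddCommGroup H] [InnerProductSpace 𝕜 H]

/-- The real polynomial calculus `p ↦ p(A)` of a bounded operator `A` on a real or complex Hilbert
space, as a ring homomorphism. -/
def polyCalc (A : H →L[𝕜] H) : ℝ[X] →+* (H →L[𝕜] H) :=
  (aeval A : 𝕜[X] →ₐ[𝕜] (H →L[𝕜] H)).toRingHom.comp (mapRingHom (algebraMap ℝ 𝕜))

lemma polyCalc_apply (A : H →L[𝕜] H) (p : ℝ[X]) :
    polyCalc A p = aeval A (p.map (algebraMap ℝ 𝕜)) := rfl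

@[simp] lemma polyCalc_X (A : H →L[𝕜] H) : polyCalc A X = A := by
  simp [polyCalc_apply]

@[simp] lemma polyCalc_C (A : H →L[𝕜] H) (c : ℝ) : polyCalc A (C c) = ((c : 𝕜)) • 1 := by
  simp [polyCalc_apply, Algebra.algebraMap_eq_smul_one]

lemma polyCalc_apply_eq_sum (A : H →L[𝕜] H) (p : ℝ[X]) {d : ℕ} (hd : p.natDegree < d) (x : H) :
    polyCalc A p x = ∑ k ∈ Finset.range d, ((p.coeff k : ℝ) : 𝕜) • (A ^ k) x := by
  have h : (p.map (algebraMap ℝ 𝕜)).natDegree < d := lt_of_le_of_lt natDegree_map_le hd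
  rw [polyCalc_apply, aeval_eq_sum_range' h]
  simp [-pow_apply_eq_iterate]

/-- If `A` maps `v` to `μ v` with `μ` real, then `p(A) v = p(μ) v`. -/
lemma polyCalc_apply_eigenvector {A : H →L[𝕜] H} {v : H} {μ : ℝ} (h : A v = (μ : 𝕜) • v)
    (p : ℝ[X]) : polyCalc A p v = ((p.eval μ : ℝ) : 𝕜) • v := by
  have hk : ∀ k : ℕ, (A ^ k) v = ((μ ^ k : ℝ) : 𝕜) • v := by
    intro k
    induction k with
    | zero => simp
    | succ k ih =>
      rw [pow_succ, mul_apply_eq_comp, h, map_smul, ih, smul_smul]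
      push_cast
      rw [pow_succ']
  rw [polyCalc_apply_eq_sum A p (Nat.lt_succ_self _), eval_eq_sum_range]
  rw [RCLike.ofReal_sum, Finset.sum_smul]
  refine Finset.sum_congr rfl fun k _ => ?_
  rw [hk, smul_smul, RCLike.ofReal_mul]

/-- Functional calculus is positive in finite dimension, by diagonalization. -/
lemma re_inner_polyCalc_nonneg_of_finiteDimensional [FiniteDimensional 𝕜 H] {A : H →L[𝕜] H}
    (hA : A.IsPositive) {B : ℝ} (hB : ∀ x, RCLike.re (inner 𝕜 (A x) x) ≤ B * ‖x‖ ^ 2)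
    {p : ℝ[X]} (hp : ∀ x ∈ Set.Icc 0 B, 0 ≤ p.eval x) (x : H) :
    0 ≤ RCLike.re (inner 𝕜 (polyCalc A p x) x) := by
  have hs : (A : H →ₗ[𝕜] H).IsSymmetric := hA.isSymmetric
  set b := hs.eigenvectorBasis rfl with hb
  set l := hs.eigenvalues rfl with hl
  have hAb : ∀ i, A (b i) = ((l i : ℝ) : 𝕜) • b i := fun i => hs.apply_eigenvectorBasis rfl i
  have hmem : ∀ i, l i ∈ Set.Icc 0 B := by
    intro i
    have e : RCLike.re (inner 𝕜 (A (b i)) (b i)) = l i := by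
      rw [hAb, inner_smul_left, inner_self_eq_norm_sq_to_K, b.orthonormal.1 i]
      simp
    constructor
    · rw [← e]
      exact hA.re_inner_nonneg_left (b i)
    · have := hB (b i)
      rw [e, b.orthonormal.1 i] at this
      simpa using this
  have hx : polyCalc A p x = ∑ i, b.repr x i • ((p.eval (l i) : ℝ) : 𝕜) • b i := by
    conv_lhs => rw [← b.sum_repr x]
    rw [map_sum]
    refine Finset.sum_congr rfl fun i _ => ?_
    rw [map_smul, polyCalc_apply_eigenvector (hAb i)]
  rw [hx, sum_inner, map_sum]
  refine Finset.sum_nonneg fun i _ => ?_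
  rw [inner_smul_left, inner_smul_left, ← b.repr_apply_apply, RCLike.conj_ofReal, mul_left_comm,
    RCLike.conj_mul, ← RCLike.ofReal_pow, ← RCLike.ofReal_mul, RCLike.ofReal_re]
  exact mul_nonneg (hp _ (hmem i)) (sq_nonneg _)

/-- The polynomial calculus of a positive operator is positive: `p(A) ≥ 0` when `p ≥ 0` on
`[0, ‖A‖]`.  For a given vector `x` and a given degree, `p(A) x` is computed in a Krylov subspace
`span {x, A x, …, A ^ d x}` by the compression of `A`, which reduces the claim to finite dimension.
-/
lemma re_inner_polyCalc_nonneg {A : H →L[𝕜] H} (hA : A.IsPositive) {p : ℝ[X]}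
    (hp : ∀ x ∈ Set.Icc 0 ‖A‖, 0 ≤ p.eval x) (x : H) :
    0 ≤ RCLike.re (inner 𝕜 (polyCalc A p x) x) := by
  set d := p.natDegree with hd
  let s : Finset H := by
    classical exact (Finset.range (d + 1)).image fun k => (A ^ k) x
  let W : Submodule 𝕜 H := Submodule.span 𝕜 (s : Set H)
  have hsW : ∀ k, k ≤ d → (A ^ k) x ∈ W := by
    intro k hk
    refine Submodule.subset_span ?_
    simp only [s, Finset.coe_image, Set.mem_image]
    exact ⟨k, by simpa using Nat.lt_succ_of_le hk, rfl⟩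
  have hfd : FiniteDimensional 𝕜 W := FiniteDimensional.span_finset 𝕜 s
  let T : W →L[𝕜] W := W.orthogonalProjectionOnto ∘L A ∘L W.subtypeL
  have hTin : ∀ u v : W, inner 𝕜 (T u) v = inner 𝕜 (A (u : H)) (v : H) := by
    intro u v
    simp only [T, ContinuousLinearMap.comp_apply]
    rw [Submodule.inner_orthogonalProjectionOnto_eq_of_mem_right]
    rfl
  have hTpos : T.IsPositive := by
    refine ⟨fun u v => ?_, fun u => ?_⟩
    · change inner 𝕜 (T u) v = inner 𝕜 u (T v)
      rw [hTin, ← inner_conj_symm u (T v), hTin, inner_conj_symm]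
      exact hA.isSymmetric _ _
    · rw [ContinuousLinearMap.reApplyInnerSelf_apply, hTin]
      exact hA.re_inner_nonneg_left _
  have hTle : ∀ u : W, RCLike.re (inner 𝕜 (T u) u) ≤ ‖A‖ * ‖u‖ ^ 2 := by
    intro u
    rw [hTin]
    calc RCLike.re (inner 𝕜 (A (u : H)) (u : H)) ≤ ‖A (u : H)‖ * ‖(u : H)‖ :=
          re_inner_le_norm _ _
      _ ≤ ‖A‖ * ‖(u : H)‖ * ‖(u : H)‖ := by gcongr; exact A.le_opNorm _
      _ = ‖A‖ * ‖u‖ ^ 2 := by rw [Submodule.coe_norm]; ring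
  let x₀ : W := ⟨x, by simpa using hsW 0 (Nat.zero_le _)⟩
  have hTk : ∀ k, k ≤ d → (((T ^ k) x₀ : W) : H) = (A ^ k) x := by
    intro k
    induction k with
    | zero => intro _; simp [x₀]
    | succ k ih =>
      intro hk
      rw [pow_succ', pow_succ', mul_apply_eq_comp, mul_apply_eq_comp]
      simp only [T, ContinuousLinearMap.comp_apply, Submodule.subtypeL_apply]
      rw [ih (by omega)]
      have : A ((A ^ k) x) ∈ W := by
        have := hsW (k + 1) hk
        rwa [pow_succ', mul_apply_eq_comp] at this
      exact Submodule.starProjection_eq_self_iff.mpr this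
  have hTp : ((polyCalc T p x₀ : W) : H) = polyCalc A p x := by
    rw [polyCalc_apply_eq_sum A p (Nat.lt_succ_self _), polyCalc_apply_eq_sum T p
      (Nat.lt_succ_self _), Submodule.coe_sum]
    refine Finset.sum_congr rfl fun k hk => ?_
    rw [Submodule.coe_smul, hTk k (Nat.lt_succ_iff.mp (Finset.mem_range.mp hk))]
  have := re_inner_polyCalc_nonneg_of_finiteDimensional hTpos hTle hp x₀
  rwa [Submodule.coe_inner, hTp] at this

lemma polyCalc_isSymmetric {A : H →L[𝕜] H} (hA : A.IsPositive) (p : ℝ[X]) (x y : H) :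
    inner 𝕜 (polyCalc A p x) y = inner 𝕜 x (polyCalc A p y) := by
  have hk : ∀ (k : ℕ) (x y : H), inner 𝕜 ((A ^ k) x) y = inner 𝕜 x ((A ^ k) y) := by
    intro k
    induction k with
    | zero => simp
    | succ k ih =>
      intro x y
      rw [pow_succ, mul_apply_eq_comp, ih, ← pow_succ, pow_succ',
        mul_apply_eq_comp]
      exact hA.isSymmetric _ _
  rw [polyCalc_apply_eq_sum A p (Nat.lt_succ_self _), polyCalc_apply_eq_sum A p
    (Nat.lt_succ_self _), sum_inner, inner_sum]
  refine Finset.sum_congr rfl fun k _ => ?_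
  rw [inner_smul_left, inner_smul_right, hk, RCLike.conj_ofReal]

lemma re_inner_polyCalc_le {A : H →L[𝕜] H} (hA : A.IsPositive) {p : ℝ[X]} {M : ℝ}
    (hp : ∀ x ∈ Set.Icc 0 ‖A‖, p.eval x ≤ M) (x : H) :
    RCLike.re (inner 𝕜 (polyCalc A p x) x) ≤ M * ‖x‖ ^ 2 := by
  have h := re_inner_polyCalc_nonneg hA (p := C M - p)
    (fun t ht => by simpa using hp t ht) x
  rw [map_sub, sub_apply, inner_sub_left, map_sub, polyCalc_C,
    smul_apply, one_apply_eq_self, inner_smul_left,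
    RCLike.conj_ofReal, RCLike.re_ofReal_mul, inner_self_eq_norm_sq] at h
  linarith

lemma norm_polyCalc_apply_le {A : H →L[𝕜] H} (hA : A.IsPositive) {p : ℝ[X]} {M : ℝ} (hM : 0 ≤ M)
    (hp : ∀ x ∈ Set.Icc 0 ‖A‖, |p.eval x| ≤ M) (x : H) : ‖polyCalc A p x‖ ≤ M * ‖x‖ := by
  have h := re_inner_polyCalc_le hA (p := p * p) (M := M ^ 2)
    (fun t ht => by
      rw [eval_mul, ← sq]
      exact sq_le_sq' (neg_le_of_abs_le (hp t ht)) (le_of_abs_le (hp t ht))) x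
  rw [map_mul, mul_apply_eq_comp, polyCalc_isSymmetric hA, inner_self_eq_norm_sq,
    ← mul_pow] at h
  exact le_of_sq_le_sq h (by positivity)

lemma norm_polyCalc_le {A : H →L[𝕜] H} (hA : A.IsPositive) {p : ℝ[X]} {M : ℝ} (hM : 0 ≤ M)
    (hp : ∀ x ∈ Set.Icc 0 ‖A‖, |p.eval x| ≤ M) : ‖polyCalc A p‖ ≤ M :=
  ContinuousLinearMap.opNorm_le_bound _ hM (norm_polyCalc_apply_le hA hM hp)

end PolynomialCalculus

/-! ### Fractional powers and the range of the square root -/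

section UniformLimits

open Polynomial

variable {𝕜 : Type*} [RCLike 𝕜] {H : Type*} [NormedAddCommGroup H] [InnerProductSpace 𝕜 H]

lemma exists_polynomial_seq_tendstoUniformlyOn {B : ℝ} {f : ℝ → ℝ}
    (hf : ContinuousOn f (Set.Icc 0 B)) :
    ∃ p : ℕ → ℝ[X], TendstoUniformlyOn (fun n x => (p n).eval x) f atTop (Set.Icc 0 B) := by
  have h : ∀ n : ℕ, ∃ p : ℝ[X], ∀ x ∈ Set.Icc 0 B, |p.eval x - f x| < 1 / ((n : ℝ) + 1) :=
    fun n => exists_polynomial_near_of_continuousOn 0 B f hf _ (by positivity)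
  choose p hp using h
  refine ⟨p, Metric.tendstoUniformlyOn_iff.mpr fun ε hε => ?_⟩
  have h0 : Tendsto (fun n : ℕ => 1 / ((n : ℝ) + 1)) atTop (𝓝 0) :=
    tendsto_one_div_add_atTop_nhds_zero_nat
  filter_upwards [h0.eventually (gt_mem_nhds hε)] with n hn x hx
  rw [dist_comm, Real.dist_eq]
  exact (hp n x hx).trans hn

/-- A map `Φ`, additive in the polynomial `p` and bounded by a multiple of the supremum norm of
`w p` on `[0, B]`, extends to uniform limits. -/
lemma tendsto_of_tendstoUniformlyOn {E : Type*} [NormedAddCommGroup E] [CompleteSpace E]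
    {Φ : ℝ[X] →+ E} {B G : ℝ} {w : ℝ → ℝ} (hG : 0 ≤ G)
    (hΦ : ∀ (p : ℝ[X]) (M : ℝ), 0 ≤ M → (∀ x ∈ Set.Icc 0 B, |w x * p.eval x| ≤ M) →
      ‖Φ p‖ ≤ M * G)
    {p : ℕ → ℝ[X]} {f : ℝ → ℝ}
    (hp : TendstoUniformlyOn (fun n x => w x * (p n).eval x) f atTop (Set.Icc 0 B)) :
    ∃ b : E, Tendsto (fun n => Φ (p n)) atTop (𝓝 b) := by
  refine cauchySeq_tendsto_of_complete (Metric.cauchySeq_iff.mpr fun ε hε => ?_)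
  obtain ⟨N, hN⟩ := eventually_atTop.mp
    (Metric.tendstoUniformlyOn_iff.mp hp (ε / (G + 1) / 2) (by positivity))
  refine ⟨N, fun m hm n hn => ?_⟩
  rw [dist_eq_norm, ← map_sub]
  refine lt_of_le_of_lt (hΦ (p m - p n) (ε / (G + 1)) (by positivity) fun x hx => ?_) ?_
  swap
  · rw [div_mul_eq_mul_div, div_lt_iff₀ (by positivity)]
    nlinarith
  have h1 := hN m hm x hx
  have h2 := hN n hn x hx
  rw [Real.dist_eq, abs_lt] at h1 h2
  rw [eval_sub, mul_sub, abs_le]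
  constructor <;> linarith

lemma tendsto_unique_of_tendstoUniformlyOn {A : H →L[𝕜] H} (hA : A.IsPositive)
    {p q : ℕ → ℝ[X]} {f : ℝ → ℝ} {B : H →L[𝕜] H}
    (hp : TendstoUniformlyOn (fun n x => (p n).eval x) f atTop (Set.Icc 0 ‖A‖))
    (hq : TendstoUniformlyOn (fun n x => (q n).eval x) f atTop (Set.Icc 0 ‖A‖))
    (hB : Tendsto (fun n => polyCalc A (p n)) atTop (𝓝 B)) :
    Tendsto (fun n => polyCalc A (q n)) atTop (𝓝 B) := by
  have h0 : Tendsto (fun n => polyCalc A (q n) - polyCalc A (p n)) atTop (𝓝 0) := by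
    rw [Metric.tendsto_atTop]
    intro ε hε
    obtain ⟨N, hN⟩ := eventually_atTop.mp
      ((Metric.tendstoUniformlyOn_iff.mp hp (ε / 4) (by positivity)).and
        (Metric.tendstoUniformlyOn_iff.mp hq (ε / 4) (by positivity)))
    refine ⟨N, fun n hn => ?_⟩
    rw [dist_zero_right, ← map_sub]
    refine lt_of_le_of_lt (norm_polyCalc_le hA (M := ε / 2) (by positivity) fun x hx => ?_)
      (by linarith)
    have h1 := (hN n hn).1 x hx
    have h2 := (hN n hn).2 x hx
    rw [Real.dist_eq, abs_lt] at h1 h2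
    rw [eval_sub, abs_le]
    constructor <;> linarith
  simpa using h0.add hB

/-- If `p n → f` uniformly on `[0, B]` and `|q f| ≤ M` there, then every bound that holds for all
`Φ p` with `|q w p| ≤ M'` passes to the limit of `Φ (p n)`. -/
lemma norm_le_of_tendstoUniformlyOn {E : Type*} [NormedAddCommGroup E]
    {Φ : ℝ[X] → E} {B G : ℝ} {w q : ℝ → ℝ} (hG : 0 ≤ G) (hq : ContinuousOn q (Set.Icc 0 B))
    (hΦ : ∀ (p : ℝ[X]) (M : ℝ), 0 ≤ M → (∀ x ∈ Set.Icc 0 B, |q x * (w x * p.eval x)| ≤ M) →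
      ‖Φ p‖ ≤ M * G)
    {p : ℕ → ℝ[X]} {f : ℝ → ℝ} {b : E}
    (hp : TendstoUniformlyOn (fun n x => w x * (p n).eval x) f atTop (Set.Icc 0 B))
    (hb : Tendsto (fun n => Φ (p n)) atTop (𝓝 b)) {M : ℝ} (hM : 0 ≤ M)
    (hqf : ∀ x ∈ Set.Icc 0 B, |q x * f x| ≤ M) : ‖b‖ ≤ M * G := by
  obtain ⟨Q, hQ⟩ := isCompact_Icc.exists_bound_of_continuousOn hq
  have hQ' : ∀ x ∈ Set.Icc 0 B, |q x| ≤ |Q| + 1 := fun x hx =>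
    (hQ x hx).trans ((le_abs_self Q).trans (by linarith))
  refine le_of_forall_pos_le_add fun ε hε => ?_
  refine le_of_tendsto hb.norm ?_
  have hpos : 0 < ε / (G + 1) := by positivity
  filter_upwards [Metric.tendstoUniformlyOn_iff.mp hp (ε / (G + 1) / (|Q| + 1)) (by positivity)]
    with n hn
  refine (hΦ (p n) (M + ε / (G + 1)) (by positivity) fun x hx => ?_).trans ?_
  · have h1 := (hn x hx).le
    rw [dist_comm, Real.dist_eq] at h1
    have e : q x * (w x * (p n).eval x) = q x * f x + q x * (w x * (p n).eval x - f x) := by ring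
    rw [e]
    refine (abs_add_le _ _).trans (add_le_add (hqf x hx) ?_)
    rw [abs_mul]
    calc |q x| * |w x * (p n).eval x - f x|
        ≤ (|Q| + 1) * (ε / (G + 1) / (|Q| + 1)) := by
          gcongr
          exact hQ' x hx
      _ = ε / (G + 1) := by field_simp
  · have : ε / (G + 1) * G ≤ ε := by
      rw [div_mul_eq_mul_div, div_le_iff₀ (by positivity)]
      nlinarith
    nlinarith

lemma isOpPow_opPow [CompleteSpace H] {A : H →L[𝕜] H} (hA : A.IsPositive) {r : ℝ} (hr : 0 < r) :
    IsOpPow A r (opPow A r) := by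
  have hex : ∃ B, IsOpPow A r B := by
    obtain ⟨p, hp⟩ := exists_polynomial_seq_tendstoUniformlyOn (B := ‖A‖) (f := fun x : ℝ => x ^ r)
      (Real.continuous_rpow_const hr.le).continuousOn
    obtain ⟨b, hb⟩ := tendsto_of_tendstoUniformlyOn (Φ := (polyCalc A).toAddMonoidHom) (B := ‖A‖)
      (w := fun _ => 1) (G := 1) zero_le_one
      (fun q M hM hq => (norm_polyCalc_le hA hM (by simpa using hq)).trans_eq (mul_one M).symm)
      (p := p) (f := fun x : ℝ => x ^ r) (by simpa using hp)
    exact ⟨b, p, hp, hb⟩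
  rw [opPow, dif_pos hex]
  exact hex.choose_spec

/-- The bound `‖q(A) A ^ r x‖ ≤ sup |q(t) t ^ r| ‖x‖`. -/
lemma norm_polyCalc_opPow_apply_le [CompleteSpace H] {A : H →L[𝕜] H} (hA : A.IsPositive) {r : ℝ}
    (hr : 0 < r) {q : ℝ[X]} {M : ℝ} (hM : 0 ≤ M)
    (hq : ∀ x ∈ Set.Icc 0 ‖A‖, |q.eval x * x ^ r| ≤ M) (x : H) :
    ‖polyCalc A q (opPow A r x)‖ ≤ M * ‖x‖ := by
  obtain ⟨p, hp, hB⟩ := isOpPow_opPow hA hr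
  refine norm_le_of_tendstoUniformlyOn (Φ := fun p => polyCalc A q (polyCalc A p x)) (B := ‖A‖)
    (w := fun _ => 1) (q := fun x => q.eval x) (norm_nonneg x) q.continuous.continuousOn
    (fun p M hM hp => ?_) (p := p) (f := fun x => x ^ r) (by simpa using hp) ?_ hM hq
  · rw [← mul_apply_eq_comp, ← map_mul]
    exact norm_polyCalc_apply_le hA hM (by simpa using hp) x
  · have h1 : Tendsto (fun n => polyCalc A (p n)) atTop (𝓝 (opPow A r)) := hB
    exact ((polyCalc A q).continuous.tendsto _).comp
      (((ContinuousLinearMap.apply 𝕜 H x).continuous.tendsto _).comp h1)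

end UniformLimits

section Factorization

open Polynomial

variable {𝕜 : Type*} [RCLike 𝕜] {H : Type*} [NormedAddCommGroup H] [InnerProductSpace 𝕜 H]
  [CompleteSpace H] {V : Type*} [NormedAddCommGroup V] [InnerProductSpace 𝕜 V] [CompleteSpace V]
  (J : H →L[𝕜] V)

lemma norm_adjoint_comp_self_eq_norm_self_comp_adjoint :
    ‖J.adjoint ∘L J‖ = ‖J ∘L J.adjoint‖ := by
  have h := ContinuousLinearMap.norm_adjoint_comp_self J.adjoint
  rw [ContinuousLinearMap.adjoint_adjoint] at h
  rw [ContinuousLinearMap.norm_adjoint_comp_self, h, LinearIsometryEquiv.norm_map]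

lemma polyCalc_adjoint_comp_self_apply (p : ℝ[X]) (v : V) :
    polyCalc (J.adjoint ∘L J) p (J.adjoint v) = J.adjoint (polyCalc (J ∘L J.adjoint) p v) := by
  have hk : ∀ k : ℕ, ((J.adjoint ∘L J) ^ k) (J.adjoint v)
      = J.adjoint (((J ∘L J.adjoint) ^ k) v) := by
    intro k
    induction k with
    | zero => simp
    | succ k ih =>
      rw [pow_succ', pow_succ', mul_apply_eq_comp, mul_apply_eq_comp, ih]
      rfl
  rw [polyCalc_apply_eq_sum _ p (Nat.lt_succ_self _), polyCalc_apply_eq_sum _ p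
    (Nat.lt_succ_self _), map_sum]
  exact Finset.sum_congr rfl fun k _ => by rw [hk, map_smul]

/-- `‖J* p(J J*)‖ ≤ sup |√t p(t)|`. -/
lemma norm_adjoint_polyCalc_apply_le {p : ℝ[X]} {M : ℝ} (hM : 0 ≤ M)
    (hp : ∀ x ∈ Set.Icc 0 ‖J ∘L J.adjoint‖, |√x * p.eval x| ≤ M) (v : V) :
    ‖J.adjoint (polyCalc (J ∘L J.adjoint) p v)‖ ≤ M * ‖v‖ := by
  have hL : (J ∘L J.adjoint).IsPositive := ContinuousLinearMap.isPositive_self_comp_adjoint J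
  have h := re_inner_polyCalc_le hL (p := p * (X * p)) (M := M ^ 2)
    (fun t ht => by
      have h1 : p.eval t * (t * p.eval t) = |√t * p.eval t| ^ 2 := by
        rw [sq_abs, mul_pow, Real.sq_sqrt ht.1]; ring
      rw [eval_mul, eval_mul, eval_X, h1]
      exact pow_le_pow_left₀ (abs_nonneg _) (hp t ht) 2) v
  rw [map_mul, map_mul, polyCalc_X, mul_apply_eq_comp, polyCalc_isSymmetric hL,
    mul_apply_eq_comp, ContinuousLinearMap.comp_apply, ← ContinuousLinearMap.adjoint_inner_right,
    inner_self_eq_norm_sq, ← mul_pow] at h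
  exact le_of_sq_le_sq h (by positivity)

lemma norm_polyCalc_comp_le {p : ℝ[X]} {M : ℝ} (hM : 0 ≤ M)
    (hp : ∀ x ∈ Set.Icc 0 ‖J ∘L J.adjoint‖, |√x * p.eval x| ≤ M) :
    ‖polyCalc (J ∘L J.adjoint) p ∘L J‖ ≤ M := by
  have hL : (J ∘L J.adjoint).IsPositive := ContinuousLinearMap.isPositive_self_comp_adjoint J
  have e : (polyCalc (J ∘L J.adjoint) p ∘L J).adjoint
      = J.adjoint ∘L polyCalc (J ∘L J.adjoint) p := by
    symm
    rw [ContinuousLinearMap.eq_adjoint_iff]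
    intro v h
    rw [ContinuousLinearMap.comp_apply, ContinuousLinearMap.adjoint_inner_left,
      polyCalc_isSymmetric hL]
    rfl
  rw [← LinearIsometryEquiv.norm_map ContinuousLinearMap.adjoint, e]
  exact ContinuousLinearMap.opNorm_le_bound _ hM (norm_adjoint_polyCalc_apply_le J hM hp)

/-- Polynomials `q n` with `√t q n(t) → t ^ s` uniformly on `[0, B]`: approximate the continuous
function `t ^ s / √(max t δ)`. -/
lemma exists_polynomial_seq_sqrt_mul {s : ℝ} (hs : 0 < s) (B : ℝ) :
    ∃ q : ℕ → ℝ[X], TendstoUniformlyOn (fun n x => √x * (q n).eval x) (fun x : ℝ => x ^ s) atTop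
      (Set.Icc 0 B) := by
  have h : ∀ n : ℕ, ∃ q : ℝ[X], ∀ x ∈ Set.Icc 0 B,
      |√x * q.eval x - x ^ s| ≤ √B * (1 / ((n : ℝ) + 1)) + (1 / ((n : ℝ) + 1)) ^ s := by
    intro n
    set d : ℝ := 1 / ((n : ℝ) + 1) with hd
    have hd0 : 0 < d := by positivity
    have hc : Continuous fun x : ℝ => x ^ s / √(max x d) := by
      refine (Real.continuous_rpow_const hs.le).div (by fun_prop) fun x => ?_
      exact (Real.sqrt_pos.mpr (lt_max_of_lt_right hd0)).ne'
    obtain ⟨q, hq⟩ := exists_polynomial_near_of_continuousOn 0 B _ hc.continuousOn d hd0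
    refine ⟨q, fun x hx => ?_⟩
    have e : √x * q.eval x - x ^ s = √x * (q.eval x - x ^ s / √(max x d))
        + (√x * (x ^ s / √(max x d)) - x ^ s) := by ring
    rw [e]
    refine (abs_add_le _ _).trans (add_le_add ?_ ?_)
    · rw [abs_mul, abs_of_nonneg (Real.sqrt_nonneg x)]
      exact mul_le_mul (Real.sqrt_le_sqrt hx.2) (hq x hx).le (abs_nonneg _) (Real.sqrt_nonneg _)
    · rcases le_total d x with hdx | hdx
      · have : √x ≠ 0 := (Real.sqrt_pos.mpr (hd0.trans_le hdx)).ne'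
        rw [max_eq_left hdx, mul_div_cancel₀ _ this, sub_self, abs_zero]
        positivity
      · have h1 : 0 ≤ x ^ s := Real.rpow_nonneg hx.1 s
        have h2 : x ^ s ≤ d ^ s := Real.rpow_le_rpow hx.1 hdx hs.le
        have h3 : 0 ≤ √x * (x ^ s / √(max x d)) := by positivity
        have h4 : √x * (x ^ s / √(max x d)) ≤ x ^ s := by
          rw [max_eq_right hdx, mul_div_assoc', div_le_iff₀ (Real.sqrt_pos.mpr hd0), mul_comm]
          exact mul_le_mul_of_nonneg_left (Real.sqrt_le_sqrt hdx) h1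
        rw [abs_le]
        constructor <;> linarith
  choose q hq using h
  refine ⟨q, Metric.tendstoUniformlyOn_iff.mpr fun ε hε => ?_⟩
  have h0 : Tendsto (fun n : ℕ => 1 / ((n : ℝ) + 1)) atTop (𝓝 0) :=
    tendsto_one_div_add_atTop_nhds_zero_nat
  have h1 : Tendsto (fun n : ℕ => √B * (1 / ((n : ℝ) + 1)) + (1 / ((n : ℝ) + 1)) ^ s) atTop
      (𝓝 0) := by
    have := (h0.const_mul (√B)).add (((Real.continuous_rpow_const hs.le).tendsto 0).comp h0)
    simpa [Real.zero_rpow hs.ne', Function.comp_def] using this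
  filter_upwards [h1.eventually (gt_mem_nhds hε)] with n hn x hx
  rw [dist_comm, Real.dist_eq]
  exact (hq n x hx).trans_lt hn

/-- For `r > 1/2` the range of `(J J*) ^ r` is contained in the range of `J`: the preimage `u` is
the limit of `J* q n(J J*) g` with `√t q n(t) → t ^ (r - 1/2)`, so that it plays the role of
`(J* J) ^ (r - 1/2) g` up to a partial isometry and obeys the corresponding spectral bounds. -/
lemma exists_preimage_opPow {r : ℝ} (hr : 1 / 2 < r) (g : V) :
    ∃ u : H, J u = opPow (J ∘L J.adjoint) r g ∧
      ∀ (q : ℝ[X]) (M : ℝ), 0 ≤ M →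
        (∀ x ∈ Set.Icc 0 ‖J ∘L J.adjoint‖, |q.eval x * x ^ (r - 1 / 2)| ≤ M) →
        ‖polyCalc (J.adjoint ∘L J) q u‖ ≤ M * ‖g‖ := by
  have hL : (J ∘L J.adjoint).IsPositive := ContinuousLinearMap.isPositive_self_comp_adjoint J
  obtain ⟨p, hp⟩ := exists_polynomial_seq_sqrt_mul (s := r - 1 / 2) (by linarith)
    ‖J ∘L J.adjoint‖
  obtain ⟨u, hu⟩ := tendsto_of_tendstoUniformlyOn (E := H)
    (Φ := AddMonoidHom.mk' (fun p => J.adjoint (polyCalc (J ∘L J.adjoint) p g))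
      fun p q => by rw [map_add, add_apply, map_add]) (B := ‖J ∘L J.adjoint‖) (w := fun x => √x)
    (norm_nonneg g) (fun q M hM hq => norm_adjoint_polyCalc_apply_le J hM hq g) hp
  have hTg : Tendsto (fun n => J.adjoint (polyCalc (J ∘L J.adjoint) (p n) g)) atTop (𝓝 u) := hu
  refine ⟨u, ?_, fun q M hM hq => ?_⟩
  · obtain ⟨p', hp', hB⟩ := isOpPow_opPow hL (r := r) (by linarith)
    have hX : TendstoUniformlyOn (fun n x => (X * p n : ℝ[X]).eval x) (fun x : ℝ => x ^ r) atTop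
        (Set.Icc 0 ‖J ∘L J.adjoint‖) := by
      rw [Metric.tendstoUniformlyOn_iff] at hp ⊢
      intro ε hε
      filter_upwards [hp (ε / (√‖J ∘L J.adjoint‖ + 1)) (by positivity)] with n hn x hx
      have h1 := hn x hx
      have e : x ^ r = √x * x ^ (r - 1 / 2) := by
        rw [Real.sqrt_eq_rpow, ← Real.rpow_add' hx.1 (by linarith)]
        congr 1; ring
      have e2 : (X * p n : ℝ[X]).eval x = √x * (√x * (p n).eval x) := by
        rw [← mul_assoc, Real.mul_self_sqrt hx.1]; simp
      rw [Real.dist_eq] at h1 ⊢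
      rw [e, e2, ← mul_sub, abs_mul, abs_of_nonneg (Real.sqrt_nonneg x)]
      rw [lt_div_iff₀ (by positivity)] at h1
      have h3 : √x ≤ √‖J ∘L J.adjoint‖ := Real.sqrt_le_sqrt hx.2
      nlinarith [abs_nonneg (x ^ (r - 1 / 2) - √x * (p n).eval x)]
    have h2 := tendsto_unique_of_tendstoUniformlyOn hL hp' hX hB
    have h3 : Tendsto (fun n => polyCalc (J ∘L J.adjoint) (X * p n) g) atTop
        (𝓝 (opPow (J ∘L J.adjoint) r g)) :=
      ((ContinuousLinearMap.apply 𝕜 V g).continuous.tendsto _).comp h2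
    refine tendsto_nhds_unique ((J.continuous.tendsto _).comp hTg) ?_
    refine h3.congr fun n => ?_
    rw [map_mul, polyCalc_X]
    rfl
  · refine norm_le_of_tendstoUniformlyOn
      (Φ := fun p => polyCalc (J.adjoint ∘L J) q (J.adjoint (polyCalc (J ∘L J.adjoint) p g)))
      (B := ‖J ∘L J.adjoint‖) (w := fun x => √x) (q := fun x => q.eval x) (norm_nonneg g)
      q.continuous.continuousOn (fun p M hM hp => ?_) hp
      (((polyCalc (J.adjoint ∘L J) q).continuous.tendsto _).comp hTg) hM hq
    rw [polyCalc_adjoint_comp_self_apply, ← mul_apply_eq_comp, ← map_mul]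
    refine norm_adjoint_polyCalc_apply_le J hM (fun x hx => ?_) g
    rw [eval_mul, mul_left_comm]
    exact hp x hx

end Factorization

/-! ### Kernel evaluation, separability, and resampling of a coordinate -/

section Evaluation

/-- The reproducing kernel Hilbert space of a Mercer kernel is separable: a function that is
orthogonal to `K(·, x) y` for `x` and `y` in countable dense sets vanishes. -/
lemma secondCountableTopology_of_continuous {𝕜 : Type*} [RCLike 𝕜] {X : Type*}
    [TopologicalSpace X] {Y : Type*} [NormedAddCommGroup Y] [InnerProductSpace 𝕜 Y]
    [CompleteSpace Y] {H : Type*} [NormedAddCommGroup H] [InnerProductSpace 𝕜 H] [CompleteSpace H]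
    [RKHS 𝕜 H X Y] (hc : ∀ f : H, Continuous f)
    [TopologicalSpace.SeparableSpace X] [SecondCountableTopology Y] :
    SecondCountableTopology H := by
  obtain ⟨s, hsc, hsd⟩ := TopologicalSpace.exists_countable_dense X
  obtain ⟨t, htc, htd⟩ := TopologicalSpace.exists_countable_dense Y
  set D : Set H :=
    (fun p : X × Y => RKHS.kerFun H p.1 p.2) '' (s ×ˢ t) with hD
  have hDc : D.Countable := (hsc.prod htc).image _
  have htop : (Submodule.span 𝕜 D).topologicalClosure = ⊤ := by
    rw [← Submodule.orthogonal_eq_bot_iff]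
    rw [Submodule.orthogonal_closure, Submodule.eq_bot_iff]
    intro f hf
    have hf1 : Continuous fun p : X × Y => f p.1 := (hc f).comp continuous_fst
    have hf2 : Continuous fun p : X × Y => inner 𝕜 p.2 (f p.1) :=
      Continuous.inner (𝕜 := 𝕜) (E := Y) continuous_snd hf1
    have h0 : (fun p : X × Y => inner 𝕜 p.2 (f p.1)) = fun _ => 0 := by
      refine Continuous.ext_on (hsd.prod htd) hf2 continuous_const ?_
      intro p hp
      change inner 𝕜 p.2 (f p.1) = 0
      rw [← RKHS.kerFun_inner (H := H)]
      have hmem : RKHS.kerFun H p.1 p.2 ∈ Submodule.span 𝕜 D :=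
        Submodule.subset_span ⟨p, hp, rfl⟩
      exact (Submodule.mem_orthogonal _ f).mp hf _ hmem
    refine RKHS.ext fun x => ext_inner_left 𝕜 fun y => ?_
    have hz : (0 : H) x = 0 := congrFun RKHS.coe_zero x
    rw [hz, inner_zero_right]
    exact congrFun h0 (x, y)
  have hsep : TopologicalSpace.IsSeparable (Set.univ : Set H) := by
    have h := (hDc.isSeparable.span (R := 𝕜)).closure
    have h2 : closure (Submodule.span 𝕜 D : Set H) = Set.univ := by
      rw [← Submodule.topologicalClosure_coe, htop, Submodule.top_coe]
    rwa [h2] at h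
  have := TopologicalSpace.isSeparable_univ_iff.mp hsep
  exact UniformSpace.secondCountable_of_separable _


variable {𝕜 : Type*} [RCLike 𝕜] {X : Type*} [TopologicalSpace X]
  {Y : Type*} [NormedAddCommGroup Y] [InnerProductSpace 𝕜 Y] [CompleteSpace Y]
  {K : Matrix X X (Y →L[𝕜] Y)} [Fact K.PosSemidef] {κ : ℝ}

lemma IsBoundedMercer.norm_kerFun_apply_le (hK : IsBoundedMercer K κ) (x : X) (y : Y) :
    ‖RKHS.kerFun (RKHS.OfKernel K) x y‖ ≤ |κ| * ‖y‖ := by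
  refine ((RKHS.kerFun (RKHS.OfKernel K) x).le_opNorm y).trans ?_
  gcongr
  rw [RKHS.norm_kerFun_eq_sqrt_norm_kernel, RKHS.OfKernel.kernel_ofKernel,
    ← Real.sqrt_sq_eq_abs]
  exact Real.sqrt_le_sqrt (hK.norm_diag_le x)

/-- For a bounded Mercer kernel the evaluation `(f, x) ↦ f x` is jointly continuous. -/
lemma IsBoundedMercer.continuous_eval (hK : IsBoundedMercer K κ) :
    Continuous fun p : RKHS.OfKernel K × X => p.1 p.2 := by
  rw [continuous_iff_continuousAt]
  rintro ⟨f, x⟩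
  rw [ContinuousAt, tendsto_iff_norm_sub_tendsto_zero]
  have h1 : Tendsto (fun p : RKHS.OfKernel K × X => |κ| * ‖p.1 - f‖ + ‖f p.2 - f x‖)
      (𝓝 (f, x)) (𝓝 0) := by
    have hc : Continuous fun p : RKHS.OfKernel K × X => |κ| * ‖p.1 - f‖ + ‖f p.2 - f x‖ :=
      (continuous_const.mul (continuous_fst.sub continuous_const).norm).add
        (((hK.continuous_mem f).comp continuous_snd).sub continuous_const).norm
    simpa using hc.tendsto (f, x)
  refine squeeze_zero (fun _ => norm_nonneg _) (fun p => ?_) h1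
  have e : p.1 p.2 - f x = (p.1 - f) p.2 + (f p.2 - f x) := by
    rw [RKHS.coe_sub, Pi.sub_apply]; abel
  rw [e]
  exact (norm_add_le _ _).trans (by gcongr; exact hK.norm_apply_le _ _)

end Evaluation

section Resampling

open ProbabilityTheory

lemma measurable_update_prod {E : Type*} [MeasurableSpace E] (n : ℕ) :
    Measurable fun p : (ℕ → E) × E => Function.update p.1 n p.2 := by
  rw [measurable_pi_iff]
  intro i
  rcases eq_or_ne i n with rfl | hi
  · simpa using measurable_snd
  · simp only [Function.update_of_ne hi]
    exact (measurable_pi_apply i).comp measurable_fst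

/-- Replacing one coordinate of an i.i.d. sequence by an independent copy does not change its law.
-/
lemma map_update_infinitePi {E : Type*} [MeasurableSpace E] (ρ : Measure E)
    [IsProbabilityMeasure ρ] (n : ℕ) :
    ((Measure.infinitePi fun _ : ℕ => ρ).prod ρ).map (fun p => Function.update p.1 n p.2)
      = Measure.infinitePi fun _ : ℕ => ρ := by
  refine Measure.eq_infinitePi _ fun s t ht => ?_
  have hm := measurable_update_prod (E := E) n
  rw [Measure.map_apply hm (MeasurableSet.pi s.countable_toSet fun i _ => ht i)]
  by_cases hn : n ∈ s
  · have e : (fun p : (ℕ → E) × E => Function.update p.1 n p.2) ⁻¹' Set.pi s t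
        = Set.pi (s.erase n : Finset ℕ) t ×ˢ t n := by
      ext ⟨z, w⟩
      simp only [Set.mem_preimage, Set.mem_pi, Set.mem_prod, Finset.mem_coe, Finset.mem_erase]
      constructor
      · intro h
        refine ⟨fun i hi => ?_, by simpa using h n hn⟩
        simpa [Function.update_of_ne hi.1] using h i hi.2
      · rintro ⟨h1, h2⟩ i hi
        rcases eq_or_ne i n with rfl | hin
        · simpa using h2
        · simpa [Function.update_of_ne hin] using h1 i ⟨hin, hi⟩
    rw [e, Measure.prod_prod, Measure.infinitePi_pi _ (fun i _ => ht i),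
      Finset.prod_erase_mul s (fun i => ρ (t i)) hn]
  · have e : (fun p : (ℕ → E) × E => Function.update p.1 n p.2) ⁻¹' Set.pi s t
        = Set.pi s t ×ˢ Set.univ := by
      ext ⟨z, w⟩
      simp only [Set.mem_preimage, Set.mem_pi, Set.mem_prod, Finset.mem_coe, Set.mem_univ,
        and_true]
      refine forall₂_congr fun i hi => ?_
      rw [Function.update_of_ne (by rintro rfl; exact hn hi)]
    rw [e, Measure.prod_prod, Measure.infinitePi_pi _ (fun i _ => ht i), measure_univ, mul_one]

/-- If `G z w` does not depend on the coordinate `z n`, then `𝔼 G z (z n) = 𝔼 ∫ G z w dρ(w)`. -/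
lemma integral_infinitePi_eval {E : Type*} [MeasurableSpace E] (ρ : Measure E)
    [IsProbabilityMeasure ρ] (n : ℕ) {G : (ℕ → E) → E → ℝ}
    (hG : ∀ z w w', G (Function.update z n w') w = G z w)
    (hGi : Integrable (fun z => G z (z n)) (Measure.infinitePi fun _ : ℕ => ρ)) :
    Integrable (fun z => ∫ w, G z w ∂ρ) (Measure.infinitePi fun _ : ℕ => ρ) ∧
    ∫ z, G z (z n) ∂(Measure.infinitePi fun _ : ℕ => ρ)
      = ∫ z, ∫ w, G z w ∂ρ ∂(Measure.infinitePi fun _ : ℕ => ρ) := by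
  have hm := measurable_update_prod (E := E) n
  have hmp : MeasurePreserving (fun p : (ℕ → E) × E => Function.update p.1 n p.2)
      ((Measure.infinitePi fun _ : ℕ => ρ).prod ρ) (Measure.infinitePi fun _ : ℕ => ρ) :=
    ⟨hm, map_update_infinitePi ρ n⟩
  have e : ((fun z => G z (z n)) ∘ fun p : (ℕ → E) × E => Function.update p.1 n p.2)
      = fun p => G p.1 p.2 := by
    funext p
    simp [hG]
  have hi : Integrable (fun p : (ℕ → E) × E => G p.1 p.2)
      ((Measure.infinitePi fun _ : ℕ => ρ).prod ρ) := by
    rw [← e]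
    exact (hmp.integrable_comp hGi.1).mpr hGi
  refine ⟨hi.integral_prod_left, ?_⟩
  rw [← integral_prod _ hi, ← e]
  conv_lhs => rw [← hmp.map_eq]
  rw [integral_map hm.aemeasurable (by rw [hmp.map_eq]; exact hGi.1)]
  rfl

end Resampling

/-! ### One step of stochastic gradient descent -/

section Regression

lemma measurePreserving_fst_fst {α β : Type*} [MeasurableSpace α] [MeasurableSpace β]
    (ρ : Measure (α × β)) : MeasurePreserving Prod.fst ρ ρ.fst :=
  ⟨measurable_fst, rfl⟩

lemma integrable_inner_of_memLp {𝕜 : Type*} [RCLike 𝕜] {α Y : Type*} [MeasurableSpace α]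
    [NormedAddCommGroup Y] [InnerProductSpace 𝕜 Y] {μ : Measure α} {f g : α → Y}
    (hf : MemLp f 2 μ) (hg : MemLp g 2 μ) : Integrable (fun a => inner 𝕜 (f a) (g a)) μ := by
  have h : Integrable (fun a => ‖f a‖ * ‖g a‖) μ := hf.norm.integrable_mul hg.norm
  exact h.mono' (hf.1.inner hg.1) (Eventually.of_forall fun a => norm_inner_le_norm _ _)

variable {𝕜 : Type*} [RCLike 𝕜] {X : Type*} [MeasurableSpace X]
  {Y : Type*} [NormedAddCommGroup Y] [InnerProductSpace 𝕜 Y] [NormedSpace ℝ Y] [CompleteSpace Y]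
  [SecondCountableTopology Y] [MeasurableSpace Y] [BorelSpace Y]
  {ρ : Measure (X × Y)} [IsProbabilityMeasure ρ] {σ : ℝ}

lemma aestronglyMeasurable_regression {e : Lp Y 2 ρ.fst} (he : regression ρ =ᵐ[ρ.fst] e) :
    AEStronglyMeasurable (regression ρ) ρ.fst :=
  (Lp.aestronglyMeasurable e).congr he.symm

lemma memLp_regression {e : Lp Y 2 ρ.fst} (he : regression ρ =ᵐ[ρ.fst] e) :
    MemLp (regression ρ) 2 ρ.fst :=
  (memLp_congr_ae he).mpr (Lp.memLp e)

lemma memLp_noise {e : Lp Y 2 ρ.fst} (he : regression ρ =ᵐ[ρ.fst] e)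
    (hnoise : ∫⁻ z, ‖z.2 - regression ρ z.1‖ₑ ^ 2 ∂ρ ≤ ENNReal.ofReal (σ ^ 2)) :
    MemLp (fun z : X × Y => z.2 - regression ρ z.1) 2 ρ := by
  have hm : AEStronglyMeasurable (fun z : X × Y => z.2 - regression ρ z.1) ρ :=
    measurable_snd.stronglyMeasurable.aestronglyMeasurable.sub
      ((aestronglyMeasurable_regression he).comp_measurePreserving (measurePreserving_fst_fst ρ))
  refine ⟨hm, ?_⟩
  rw [eLpNorm_lt_top_iff_lintegral_rpow_enorm_lt_top (by norm_num) (by norm_num)]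
  simpa using hnoise.trans_lt ENNReal.ofReal_lt_top

lemma risk_regression_le {e : Lp Y 2 ρ.fst} (he : regression ρ =ᵐ[ρ.fst] e)
    (hnoise : ∫⁻ z, ‖z.2 - regression ρ z.1‖ₑ ^ 2 ∂ρ ≤ ENNReal.ofReal (σ ^ 2)) :
    risk ρ (regression ρ) ≤ σ ^ 2 := by
  have h1 := (memLp_noise he hnoise).1
  rw [risk]
  simp_rw [norm_sub_rev (regression ρ _)]
  rw [integral_eq_lintegral_of_nonneg_ae (Eventually.of_forall fun _ => by positivity)
    (by fun_prop)]
  refine ENNReal.toReal_le_of_le_ofReal (sq_nonneg σ) ?_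
  refine le_trans (lintegral_mono fun z => ?_) hnoise
  rw [← ofReal_norm, ENNReal.ofReal_pow (norm_nonneg _)]

/-- The noise `y - h†(x)` is orthogonal to every square integrable function of `x`. -/
lemma integral_inner_noise {e : Lp Y 2 ρ.fst} (he : regression ρ =ᵐ[ρ.fst] e)
    (hnoise : ∫⁻ z, ‖z.2 - regression ρ z.1‖ₑ ^ 2 ∂ρ ≤ ENNReal.ofReal (σ ^ 2))
    {f : X → Y} (hf : MemLp f 2 ρ.fst) :
    Integrable (fun z : X × Y => inner 𝕜 (f z.1) (z.2 - regression ρ z.1)) ρ ∧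
    ∫ z : X × Y, inner 𝕜 (f z.1) (z.2 - regression ρ z.1) ∂ρ = 0 := by
  have hn := memLp_noise he hnoise
  have hf' : MemLp (fun z : X × Y => f z.1) 2 ρ :=
    hf.comp_measurePreserving (measurePreserving_fst_fst ρ)
  have hi : Integrable (fun z : X × Y => inner 𝕜 (f z.1) (z.2 - regression ρ z.1)) ρ :=
    integrable_inner_of_memLp hf' hn
  refine ⟨hi, ?_⟩
  rw [← Measure.integral_condKernel hi]
  refine integral_eq_zero_of_ae ?_
  filter_upwards [(hn.integrable (by norm_num)).condKernel_ae] with x hx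
  have hy : Integrable (fun y : Y => y) (ρ.condKernel x) := by
    have := hx.add (integrable_const (regression ρ x))
    simpa [Pi.add_def] using this
  have h0 : ∫ y, y - regression ρ x ∂(ρ.condKernel x) = 0 := by
    rw [integral_sub hy (integrable_const _), integral_const]
    simp [regression]
  change ∫ y, inner 𝕜 (f x) (y - regression ρ x) ∂(ρ.condKernel x) = 0
  rw [integral_inner hx, h0, inner_zero_right]

end Regression

section Step

lemma stronglyMeasurable_kerFun {𝕜 : Type*} [RCLike 𝕜] {X : Type*} [TopologicalSpace X]
    [PolishSpace X] [MeasurableSpace X] [BorelSpace X] {Y : Type*} [NormedAddCommGroup Y]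
    [InnerProductSpace 𝕜 Y] [CompleteSpace Y] [SecondCountableTopology Y] [MeasurableSpace Y]
    [BorelSpace Y] {H : Type*} [NormedAddCommGroup H] [InnerProductSpace 𝕜 H]
    [CompleteSpace H] [RKHS 𝕜 H X Y] (hc : Continuous fun p : H × X => p.1 p.2)
    {α : Type*} [MeasurableSpace α]
    {h : α → H} (hh : StronglyMeasurable h) {w : α → X × Y} (hw : Measurable w) :
    StronglyMeasurable fun a => RKHS.kerFun H (w a).1 (h a (w a).1 - (w a).2) := by
  have hcf : ∀ f : H, Continuous f := fun f => hc.comp (Continuous.prodMk_right f)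
  have : SecondCountableTopology H := secondCountableTopology_of_continuous hcf
  have hx : StronglyMeasurable fun a => (w a).1 := hw.fst.stronglyMeasurable
  have hy : StronglyMeasurable fun a => (w a).2 := hw.snd.stronglyMeasurable
  have h2 : StronglyMeasurable fun a => h a (w a).1 := hc.comp_stronglyMeasurable (hh.prodMk hx)
  refine stronglyMeasurable_of_inner (𝕜 := 𝕜) fun f => ?_
  have h1 : StronglyMeasurable fun a => f (w a).1 := (hcf f).comp_stronglyMeasurable hx
  have e : (fun a => inner 𝕜 f (RKHS.kerFun H (w a).1 (h a (w a).1 - (w a).2)))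
      = fun a => inner 𝕜 (f (w a).1) (h a (w a).1 - (w a).2) :=
    funext fun a => RKHS.inner_kerFun _ _ _
  rw [e]
  exact h1.inner (h2.sub hy)


variable {𝕜 : Type*} [RCLike 𝕜] {X : Type*} [TopologicalSpace X]
  [MeasurableSpace X] [BorelSpace X]
  {Y : Type*} [NormedAddCommGroup Y] [InnerProductSpace 𝕜 Y] [NormedSpace ℝ Y] [CompleteSpace Y]
  [SecondCountableTopology Y] [MeasurableSpace Y] [BorelSpace Y]
  {ρ : Measure (X × Y)} [IsProbabilityMeasure ρ] {σ : ℝ}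
  {K : Matrix X X (Y →L[𝕜] Y)} [Fact K.PosSemidef] {κ : ℝ}

lemma norm_sq_eq_integral (𝕜 : Type*) [RCLike 𝕜] {α Y : Type*} [MeasurableSpace α]
    [NormedAddCommGroup Y] [InnerProductSpace 𝕜 Y] {μ : Measure α} (f : Lp Y 2 μ) :
    ‖f‖ ^ 2 = ∫ x, ‖f x‖ ^ 2 ∂μ := by
  have h := inner_self_eq_norm_sq (𝕜 := 𝕜) f
  rw [← h, L2.inner_def, ← RCLike.reCLM_apply, ← ContinuousLinearMap.integral_comp_comm _
    (L2.integrable_inner f f)]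
  refine integral_congr_ae (Eventually.of_forall fun x => ?_)
  simp

/-- Bias-variance decomposition of the risk: `ℰ(h) = ℰ(h†) + ‖h - h†‖²`, together with the
integrability that makes the left-hand side meaningful. -/
lemma risk_eq (hK : IsBoundedMercer K κ) {e : Lp Y 2 ρ.fst} (he : regression ρ =ᵐ[ρ.fst] e)
    (hnoise : ∫⁻ z, ‖z.2 - regression ρ z.1‖ₑ ^ 2 ∂ρ ≤ ENNReal.ofReal (σ ^ 2))
    (h : RKHS.OfKernel K) :
    MemLp (fun z : X × Y => h z.1 - z.2) 2 ρ ∧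
    risk ρ h = ‖inclusion hK ρ.fst h - e‖ ^ 2 + risk ρ (regression ρ) := by
  have hn := memLp_noise he hnoise
  have hd : MemLp (fun x => h x - regression ρ x) 2 ρ.fst :=
    (hK.memLp ρ.fst h).sub (memLp_regression he)
  have hd' : MemLp (fun z : X × Y => h z.1 - regression ρ z.1) 2 ρ :=
    hd.comp_measurePreserving (measurePreserving_fst_fst ρ)
  have e1 : (fun z : X × Y => h z.1 - z.2)
      = fun z => (h z.1 - regression ρ z.1) - (z.2 - regression ρ z.1) := by
    funext z; abel
  refine ⟨by rw [e1]; exact hd'.sub hn, ?_⟩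
  obtain ⟨hoi, ho⟩ := integral_inner_noise (𝕜 := 𝕜) he hnoise hd
  have hre : ∫ z : X × Y, RCLike.re (inner 𝕜 (h z.1 - regression ρ z.1)
      (z.2 - regression ρ z.1)) ∂ρ = 0 := by
    rw [integral_re hoi, ho, map_zero]
  have hsq : ‖inclusion hK ρ.fst h - e‖ ^ 2
      = ∫ z : X × Y, ‖h z.1 - regression ρ z.1‖ ^ 2 ∂ρ := by
    rw [norm_sq_eq_integral 𝕜]
    have h1 : ∫ x, ‖(inclusion hK ρ.fst h - e : Lp Y 2 ρ.fst) x‖ ^ 2 ∂ρ.fst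
        = ∫ x, ‖h x - regression ρ x‖ ^ 2 ∂ρ.fst := by
      refine integral_congr_ae ?_
      filter_upwards [Lp.coeFn_sub (inclusion hK ρ.fst h) e, coeFn_inclusion hK ρ.fst h, he]
        with x h1 h2 h3
      rw [h1, Pi.sub_apply, h2, h3]
    have hm : AEStronglyMeasurable (fun x => ‖h x - regression ρ x‖ ^ 2) (ρ.map Prod.fst) :=
      hd.1.norm.pow 2
    rw [h1, Measure.fst, integral_map measurable_fst.aemeasurable hm]
  rw [hsq, risk, risk]
  have e2 : ∀ z : X × Y, ‖h z.1 - z.2‖ ^ 2 = ‖h z.1 - regression ρ z.1‖ ^ 2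
      - 2 * RCLike.re (inner 𝕜 (h z.1 - regression ρ z.1) (z.2 - regression ρ z.1))
      + ‖regression ρ z.1 - z.2‖ ^ 2 := by
    intro z
    rw [norm_sub_rev (regression ρ z.1), ← norm_sub_sq (𝕜 := 𝕜)]
    congr 2; abel
  simp_rw [e2]
  have i1 : Integrable (fun z : X × Y => ‖h z.1 - regression ρ z.1‖ ^ 2) ρ :=
    hd'.integrable_norm_pow (by norm_num)
  have i3 : Integrable (fun z : X × Y => ‖regression ρ z.1 - z.2‖ ^ 2) ρ := by
    simp_rw [norm_sub_rev (regression ρ _)]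
    exact hn.integrable_norm_pow (by norm_num)
  have i2 : Integrable (fun z : X × Y => 2 * RCLike.re (inner 𝕜 (h z.1 - regression ρ z.1)
      (z.2 - regression ρ z.1))) ρ := hoi.re.const_mul 2
  have i12 : Integrable (fun z : X × Y => ‖h z.1 - regression ρ z.1‖ ^ 2
      - 2 * RCLike.re (inner 𝕜 (h z.1 - regression ρ z.1) (z.2 - regression ρ z.1))) ρ :=
    i1.sub i2
  rw [integral_add i12 i3, integral_sub i1 i2, integral_const_mul, hre]
  ring

/-- The mean of the stochastic gradient `K(·, x) (h(x) - y)`, tested against `f` in the reproducing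
kernel Hilbert space, is the exact gradient `ι* (ι h - h†)`. -/
lemma integral_inner_kerFun (hK : IsBoundedMercer K κ) {e : Lp Y 2 ρ.fst}
    (he : regression ρ =ᵐ[ρ.fst] e)
    (hnoise : ∫⁻ z, ‖z.2 - regression ρ z.1‖ₑ ^ 2 ∂ρ ≤ ENNReal.ofReal (σ ^ 2))
    (f h : RKHS.OfKernel K) :
    Integrable (fun z : X × Y =>
      inner 𝕜 f (RKHS.kerFun (RKHS.OfKernel K) z.1 (h z.1 - z.2))) ρ ∧
    ∫ z : X × Y, inner 𝕜 f (RKHS.kerFun (RKHS.OfKernel K) z.1 (h z.1 - z.2)) ∂ρ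
      = inner 𝕜 f ((inclusion hK ρ.fst).adjoint (inclusion hK ρ.fst h - e)) := by
  have hf := hK.memLp ρ.fst f
  have hd : MemLp (fun x => h x - regression ρ x) 2 ρ.fst :=
    (hK.memLp ρ.fst h).sub (memLp_regression he)
  obtain ⟨hoi, ho⟩ := integral_inner_noise (𝕜 := 𝕜) he hnoise hf
  have e1 : (fun z : X × Y => inner 𝕜 f (RKHS.kerFun (RKHS.OfKernel K) z.1 (h z.1 - z.2)))
      = fun z => inner 𝕜 (f z.1) (h z.1 - regression ρ z.1)
        - inner 𝕜 (f z.1) (z.2 - regression ρ z.1) := by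
    funext z
    rw [RKHS.inner_kerFun, ← inner_sub_right]
    congr 1; abel
  have hi : Integrable (fun x => inner 𝕜 (f x) (h x - regression ρ x)) ρ.fst :=
    integrable_inner_of_memLp hf hd
  have hi' : Integrable (fun z : X × Y => inner 𝕜 (f z.1) (h z.1 - regression ρ z.1)) ρ :=
    (measurePreserving_fst_fst ρ).integrable_comp_of_integrable hi
  rw [e1]
  refine ⟨hi'.sub hoi, ?_⟩
  rw [integral_sub hi' hoi, ho, sub_zero, ContinuousLinearMap.adjoint_inner_right, L2.inner_def]
  have h1 : ∫ z : X × Y, inner 𝕜 (f z.1) (h z.1 - regression ρ z.1) ∂ρ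
      = ∫ x, inner 𝕜 (f x) (h x - regression ρ x) ∂ρ.fst := by
    rw [Measure.fst, integral_map measurable_fst.aemeasurable hi.1]
  rw [h1]
  refine integral_congr_ae ?_
  filter_upwards [Lp.coeFn_sub (inclusion hK ρ.fst h) e, coeFn_inclusion hK ρ.fst h, he,
    coeFn_inclusion hK ρ.fst f] with x h1 h2 h3 h4
  rw [h1, Pi.sub_apply, h2, h3, h4]

variable [PolishSpace X]

/-- One step of stochastic gradient descent from a deterministic point `h`, measured through a
bounded operator `A`: the mean square is at most that of the exact gradient step plus the second
moment of the stochastic gradient. -/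
lemma integral_step_le (hK : IsBoundedMercer K κ) {e : Lp Y 2 ρ.fst}
    (he : regression ρ =ᵐ[ρ.fst] e)
    (hnoise : ∫⁻ z, ‖z.2 - regression ρ z.1‖ₑ ^ 2 ∂ρ ≤ ENNReal.ofReal (σ ^ 2))
    {V : Type*} [NormedAddCommGroup V] [InnerProductSpace 𝕜 V] [CompleteSpace V]
    (A : RKHS.OfKernel K →L[𝕜] V) (v : V) (η : ℝ) (h : RKHS.OfKernel K) :
    ∫ z : X × Y, ‖A (h - (η : 𝕜) • RKHS.kerFun (RKHS.OfKernel K) z.1 (h z.1 - z.2)) - v‖ ^ 2 ∂ρ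
      ≤ ‖A (h - (η : 𝕜) • (inclusion hK ρ.fst).adjoint (inclusion hK ρ.fst h - e)) - v‖ ^ 2
        + η ^ 2 * ‖A‖ ^ 2 * κ ^ 2 * (‖inclusion hK ρ.fst h - e‖ ^ 2 + σ ^ 2) := by
  obtain ⟨hres, hrisk⟩ := risk_eq hK he hnoise h
  set b := (inclusion hK ρ.fst).adjoint (inclusion hK ρ.fst h - e) with hb
  set ξ : X × Y → RKHS.OfKernel K :=
    fun z => RKHS.kerFun (RKHS.OfKernel K) z.1 (h z.1 - z.2) with hξ
  have hξm : StronglyMeasurable ξ :=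
    stronglyMeasurable_kerFun hK.continuous_eval stronglyMeasurable_const measurable_id
  have hξ2 : MemLp ξ 2 ρ :=
    hres.of_le_mul hξm.aestronglyMeasurable
      (Eventually.of_forall fun z => hK.norm_kerFun_apply_le z.1 (h z.1 - z.2))
  have hAξ : Integrable (fun z => ‖A (ξ z)‖ ^ 2) ρ :=
    (A.comp_memLp' hξ2).integrable_norm_pow (by norm_num)
  set w := A h - v with hw
  obtain ⟨hi, hint⟩ := integral_inner_kerFun hK he hnoise (A.adjoint w) h
  have hi' : Integrable (fun z => RCLike.re (inner 𝕜 (A.adjoint w) (ξ z))) ρ := hi.re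
  have hint' : ∫ z, RCLike.re (inner 𝕜 (A.adjoint w) (ξ z)) ∂ρ
      = RCLike.re (inner 𝕜 w (A b)) := by
    rw [integral_re hi, hint, ContinuousLinearMap.adjoint_inner_left]
  have expand : ∀ x : RKHS.OfKernel K, ‖A (h - (η : 𝕜) • x) - v‖ ^ 2
      = ‖w‖ ^ 2 - 2 * η * RCLike.re (inner 𝕜 (A.adjoint w) x) + η ^ 2 * ‖A x‖ ^ 2 := by
    intro x
    have e1 : A (h - (η : 𝕜) • x) - v = w - (η : 𝕜) • A x := by
      rw [map_sub, map_smul, hw]; abel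
    rw [e1, norm_sub_sq (𝕜 := 𝕜), inner_smul_right, RCLike.re_ofReal_mul, norm_smul, mul_pow,
      RCLike.norm_ofReal, sq_abs, ContinuousLinearMap.adjoint_inner_left]
    ring
  have hbound : ∫ z, ‖A (ξ z)‖ ^ 2 ∂ρ
      ≤ ‖A‖ ^ 2 * κ ^ 2 * (‖inclusion hK ρ.fst h - e‖ ^ 2 + σ ^ 2) := by
    calc ∫ z, ‖A (ξ z)‖ ^ 2 ∂ρ ≤ ∫ z : X × Y, ‖A‖ ^ 2 * κ ^ 2 * ‖h z.1 - z.2‖ ^ 2 ∂ρ := by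
          refine integral_mono hAξ ((hres.integrable_norm_pow (by norm_num)).const_mul _)
            fun z => ?_
          have h1 : ‖A (ξ z)‖ ≤ ‖A‖ * (|κ| * ‖h z.1 - z.2‖) :=
            (A.le_opNorm _).trans (by gcongr; exact hK.norm_kerFun_apply_le _ _)
          calc ‖A (ξ z)‖ ^ 2 ≤ (‖A‖ * (|κ| * ‖h z.1 - z.2‖)) ^ 2 := by gcongr
            _ = ‖A‖ ^ 2 * κ ^ 2 * ‖h z.1 - z.2‖ ^ 2 := by
              rw [mul_pow, mul_pow, sq_abs]; ring
      _ = ‖A‖ ^ 2 * κ ^ 2 * risk ρ h := by rw [integral_const_mul, risk]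
      _ ≤ _ := by
          rw [hrisk]
          gcongr
          exact risk_regression_le he hnoise
  change ∫ z, ‖A (h - (η : 𝕜) • ξ z) - v‖ ^ 2 ∂ρ ≤ _
  simp_rw [expand]
  have i2 : Integrable (fun z => 2 * η * RCLike.re (inner 𝕜 (A.adjoint w) (ξ z))) ρ :=
    hi'.const_mul _
  have i12 : Integrable (fun z => ‖w‖ ^ 2
      - 2 * η * RCLike.re (inner 𝕜 (A.adjoint w) (ξ z))) ρ := (integrable_const _).sub i2
  rw [integral_add i12 (hAξ.const_mul _), integral_sub (integrable_const _) i2,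
    integral_const_mul, integral_const_mul,
    hint', integral_const, probReal_univ, one_smul, ContinuousLinearMap.adjoint_inner_left]
  have h2 : η ^ 2 * ∫ z, ‖A (ξ z)‖ ^ 2 ∂ρ
      ≤ η ^ 2 * (‖A‖ ^ 2 * κ ^ 2 * (‖inclusion hK ρ.fst h - e‖ ^ 2 + σ ^ 2)) := by gcongr
  nlinarith [mul_nonneg (sq_nonneg η) (sq_nonneg ‖A b‖)]

end Step

/-! ### The error decomposition along the iteration -/

section Iterates

variable {𝕜 : Type*} [RCLike 𝕜] {X : Type*}
  {Y : Type*} [NormedAddCommGroup Y] [InnerProductSpace 𝕜 Y] [CompleteSpace Y]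
  {K : Matrix X X (Y →L[𝕜] Y)} [Fact K.PosSemidef]

lemma iterate_update (η : ℕ → ℝ) (z : ℕ → X × Y) (w : X × Y) {m n : ℕ} (hn : n < m) :
    iterate K η (Function.update z m w) n = iterate K η z n := by
  induction n with
  | zero => rfl
  | succ n ih =>
    have h : Function.update z m w (n + 1) = z (n + 1) := Function.update_of_ne hn.ne _ _
    rw [iterate, iterate, ih (by omega), h]

variable {κ : ℝ} [TopologicalSpace X] [PolishSpace X] [MeasurableSpace X] [BorelSpace X]
  [SecondCountableTopology Y] [MeasurableSpace Y] [BorelSpace Y]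

lemma stronglyMeasurable_iterate (hK : IsBoundedMercer K κ) (η : ℕ → ℝ) (n : ℕ) :
    StronglyMeasurable fun z : ℕ → X × Y => iterate K η z n := by
  induction n with
  | zero => exact stronglyMeasurable_const
  | succ n ih =>
    have h := stronglyMeasurable_kerFun hK.continuous_eval ih (measurable_pi_apply (n + 1))
    exact ih.sub (h.const_smul (η (n + 1) : 𝕜))

variable [NormedSpace ℝ Y] {ρ : Measure (X × Y)} [IsProbabilityMeasure ρ] {σ : ℝ}

lemma memLp_iterate (hK : IsBoundedMercer K κ) {e : Lp Y 2 ρ.fst}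
    (he : regression ρ =ᵐ[ρ.fst] e)
    (hnoise : ∫⁻ z, ‖z.2 - regression ρ z.1‖ₑ ^ 2 ∂ρ ≤ ENNReal.ofReal (σ ^ 2))
    (η : ℕ → ℝ) (n : ℕ) :
    MemLp (fun z : ℕ → X × Y => iterate K η z n) 2 (Measure.infinitePi fun _ : ℕ => ρ) := by
  induction n with
  | zero => exact MemLp.zero
  | succ n ih =>
    have hy : MemLp (fun z : X × Y => z.2) 2 ρ := by
      have h := (risk_eq hK he hnoise 0).1.neg
      have e1 : -(fun z : X × Y => (0 : RKHS.OfKernel K) z.1 - z.2) = fun z => z.2 := by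
        funext z
        rw [RKHS.coe_zero]
        simp
      rwa [e1] at h
    have hy' : MemLp (fun z : ℕ → X × Y => (z (n + 1)).2) 2
        (Measure.infinitePi fun _ : ℕ => ρ) :=
      hy.comp_measurePreserving (measurePreserving_eval_infinitePi (fun _ : ℕ => ρ) (n + 1))
    have hb : MemLp (fun z : ℕ → X × Y => |κ| * ‖iterate K η z n‖ + ‖(z (n + 1)).2‖) 2
        (Measure.infinitePi fun _ : ℕ => ρ) := (ih.norm.const_mul _).add hy'.norm
    have hk : MemLp (fun z : ℕ → X × Y => RKHS.kerFun (RKHS.OfKernel K) (z (n + 1)).1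
        (iterate K η z n (z (n + 1)).1 - (z (n + 1)).2)) 2
        (Measure.infinitePi fun _ : ℕ => ρ) := by
      refine hb.of_le_mul (c := |κ|) (stronglyMeasurable_kerFun hK.continuous_eval
        (stronglyMeasurable_iterate hK η n)
        (measurable_pi_apply (n + 1))).aestronglyMeasurable (Eventually.of_forall fun z => ?_)
      refine (hK.norm_kerFun_apply_le _ _).trans ?_
      gcongr
      refine (norm_sub_le _ _).trans ((add_le_add_left (hK.norm_apply_le _ _) _).trans ?_)
      exact le_abs_self _
    exact ih.sub (hk.const_smul (η (n + 1) : 𝕜))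

lemma integrable_norm_iterate_sub_sq (hK : IsBoundedMercer K κ) {e : Lp Y 2 ρ.fst}
    (he : regression ρ =ᵐ[ρ.fst] e)
    (hnoise : ∫⁻ z, ‖z.2 - regression ρ z.1‖ₑ ^ 2 ∂ρ ≤ ENNReal.ofReal (σ ^ 2))
    {V : Type*} [NormedAddCommGroup V] [InnerProductSpace 𝕜 V]
    (A : RKHS.OfKernel K →L[𝕜] V) (v : V) (η : ℕ → ℝ) (n : ℕ) :
    Integrable (fun z : ℕ → X × Y => ‖A (iterate K η z n) - v‖ ^ 2)
      (Measure.infinitePi fun _ : ℕ => ρ) :=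
  ((A.comp_memLp' (memLp_iterate hK he hnoise η n)).sub (memLp_const v)).integrable_norm_pow
    (by norm_num)

/-- One step of stochastic gradient descent in mean square. -/
lemma integral_iterate_succ_le (hK : IsBoundedMercer K κ) {e : Lp Y 2 ρ.fst}
    (he : regression ρ =ᵐ[ρ.fst] e)
    (hnoise : ∫⁻ z, ‖z.2 - regression ρ z.1‖ₑ ^ 2 ∂ρ ≤ ENNReal.ofReal (σ ^ 2))
    {V : Type*} [NormedAddCommGroup V] [InnerProductSpace 𝕜 V] [CompleteSpace V]
    {A A' : RKHS.OfKernel K →L[𝕜] V} {v v' : V} {η : ℕ → ℝ} {n : ℕ}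
    (hA : ∀ h : RKHS.OfKernel K, A (h - (η (n + 1) : 𝕜) •
      (inclusion hK ρ.fst).adjoint (inclusion hK ρ.fst h - e)) - v = A' h - v') :
    ∫ z : ℕ → X × Y, ‖A (iterate K η z (n + 1)) - v‖ ^ 2 ∂(Measure.infinitePi fun _ : ℕ => ρ)
      ≤ ∫ z : ℕ → X × Y, ‖A' (iterate K η z n) - v'‖ ^ 2 ∂(Measure.infinitePi fun _ : ℕ => ρ)
        + η (n + 1) ^ 2 * ‖A‖ ^ 2 * κ ^ 2 * (∫ z : ℕ → X × Y,
          ‖inclusion hK ρ.fst (iterate K η z n) - e‖ ^ 2 ∂(Measure.infinitePi fun _ : ℕ => ρ)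
            + σ ^ 2) := by
  have hi := integrable_norm_iterate_sub_sq hK he hnoise A v η (n + 1)
  obtain ⟨hG, hGe⟩ := integral_infinitePi_eval ρ (n + 1)
    (G := fun z w => ‖A (iterate K η z n - (η (n + 1) : 𝕜) •
      RKHS.kerFun (RKHS.OfKernel K) w.1 (iterate K η z n w.1 - w.2)) - v‖ ^ 2)
    (fun z w w' => by simp only [iterate_update η z w' (Nat.lt_succ_self n)]) hi
  have h1 := integrable_norm_iterate_sub_sq hK he hnoise A' v' η n
  have h2 := integrable_norm_iterate_sub_sq hK he hnoise (inclusion hK ρ.fst) e η n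
  have h3 : Integrable (fun z : ℕ → X × Y => η (n + 1) ^ 2 * ‖A‖ ^ 2 * κ ^ 2 *
      (‖inclusion hK ρ.fst (iterate K η z n) - e‖ ^ 2 + σ ^ 2))
      (Measure.infinitePi fun _ : ℕ => ρ) := (h2.add (integrable_const _)).const_mul _
  refine (hGe.trans_le (integral_mono hG (h1.add h3) fun z => ?_)).trans_eq ?_
  · refine (integral_step_le hK he hnoise A v (η (n + 1)) (iterate K η z n)).trans_eq ?_
    rw [hA]
    rfl
  · simp only [Pi.add_apply]
    rw [integral_add h1 h3, integral_const_mul, integral_add h2 (integrable_const _),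
      integral_const, probReal_univ, one_smul]

/-- Error decomposition of stochastic gradient descent.  If `A k` and `v k` propagate the exact
gradient steps backwards from `T`, then the mean square error at `T` is at most the error of the
exact iteration plus the accumulated contributions of the gradient noise. -/
lemma integral_iterate_le (hK : IsBoundedMercer K κ) {e : Lp Y 2 ρ.fst}
    (he : regression ρ =ᵐ[ρ.fst] e)
    (hnoise : ∫⁻ z, ‖z.2 - regression ρ z.1‖ₑ ^ 2 ∂ρ ≤ ENNReal.ofReal (σ ^ 2))
    {V : Type*} [NormedAddCommGroup V] [InnerProductSpace 𝕜 V] [CompleteSpace V]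
    {A : ℕ → RKHS.OfKernel K →L[𝕜] V} {v : ℕ → V} {η : ℕ → ℝ} {T : ℕ}
    (hA : ∀ k < T, ∀ h : RKHS.OfKernel K, A (k + 1) (h - (η (k + 1) : 𝕜) •
      (inclusion hK ρ.fst).adjoint (inclusion hK ρ.fst h - e)) - v (k + 1) = A k h - v k)
    {n : ℕ} (hn : n ≤ T) :
    ∫ z : ℕ → X × Y, ‖A n (iterate K η z n) - v n‖ ^ 2 ∂(Measure.infinitePi fun _ : ℕ => ρ)
      ≤ ‖v 0‖ ^ 2 + ∑ k ∈ Finset.range n, η (k + 1) ^ 2 * ‖A (k + 1)‖ ^ 2 * κ ^ 2 *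
        (∫ z : ℕ → X × Y, ‖inclusion hK ρ.fst (iterate K η z k) - e‖ ^ 2
          ∂(Measure.infinitePi fun _ : ℕ => ρ) + σ ^ 2) := by
  induction n with
  | zero => simp [iterate]
  | succ n ih =>
    rw [Finset.sum_range_succ, ← add_assoc]
    refine (integral_iterate_succ_le hK he hnoise (hA n (by omega))).trans ?_
    gcongr
    exact ih (by omega)

end Iterates

/-! ### Spectral bounds and the error for general step sizes -/

section StepPolynomials

open Polynomial

/-- The polynomial `∏_{j=k+1}^T (1 - η_j t)`, which propagates the error of gradient descent from
the iterate after `k` steps to the iterate after `T` steps. -/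
def stepPoly (η : ℕ → ℝ) (T k : ℕ) : ℝ[X] :=
  ∏ j ∈ Finset.Ico (k + 1) (T + 1), (1 - C (η j) * X)

lemma stepPoly_self (η : ℕ → ℝ) (T : ℕ) : stepPoly η T T = 1 := by
  simp [stepPoly]

lemma stepPoly_succ_mul (η : ℕ → ℝ) {T k : ℕ} (hk : k < T) :
    stepPoly η T (k + 1) * (1 - C (η (k + 1)) * X) = stepPoly η T k := by
  rw [stepPoly, stepPoly, Finset.prod_eq_prod_Ico_succ_bot (by omega : k + 1 < T + 1), mul_comm]

variable {η : ℕ → ℝ} {B : ℝ} {T : ℕ}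

lemma eval_stepPoly (η : ℕ → ℝ) (T k : ℕ) (x : ℝ) :
    (stepPoly η T k).eval x = ∏ j ∈ Finset.Ico (k + 1) (T + 1), (1 - η j * x) := by
  simp [stepPoly, eval_prod]

lemma eval_stepPoly_nonneg (hη : ∀ j, 1 ≤ j → 0 ≤ η j) (hB : ∀ j, 1 ≤ j → η j * B ≤ 1)
    (k : ℕ) {x : ℝ} (hx : x ∈ Set.Icc 0 B) : 0 ≤ (stepPoly η T k).eval x := by
  rw [eval_stepPoly]
  refine Finset.prod_nonneg fun j hj => sub_nonneg.mpr ?_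
  have hj1 : 1 ≤ j := by have := (Finset.mem_Ico.mp hj).1; omega
  exact (mul_le_mul_of_nonneg_left hx.2 (hη j hj1)).trans (hB j hj1)

lemma eval_stepPoly_le_exp (hη : ∀ j, 1 ≤ j → 0 ≤ η j) (hB : ∀ j, 1 ≤ j → η j * B ≤ 1)
    (k : ℕ) {x : ℝ} (hx : x ∈ Set.Icc 0 B) :
    (stepPoly η T k).eval x ≤ Real.exp (-(x * ∑ j ∈ Finset.Ico (k + 1) (T + 1), η j)) := by
  rw [eval_stepPoly, Finset.mul_sum, ← Finset.sum_neg_distrib, Real.exp_sum]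
  refine Finset.prod_le_prod (fun j hj => sub_nonneg.mpr ?_) fun j _ => ?_
  · have hj1 : 1 ≤ j := by have := (Finset.mem_Ico.mp hj).1; omega
    exact (mul_le_mul_of_nonneg_left hx.2 (hη j hj1)).trans (hB j hj1)
  · rw [mul_comm x]
    exact Real.one_sub_le_exp_neg _

lemma abs_eval_stepPoly_le_one (hη : ∀ j, 1 ≤ j → 0 ≤ η j) (hB : ∀ j, 1 ≤ j → η j * B ≤ 1)
    (k : ℕ) {x : ℝ} (hx : x ∈ Set.Icc 0 B) : |(stepPoly η T k).eval x| ≤ 1 := by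
  rw [abs_of_nonneg (eval_stepPoly_nonneg hη hB k hx)]
  refine (eval_stepPoly_le_exp hη hB k hx).trans (Real.exp_le_one_iff.mpr ?_)
  refine neg_nonpos.mpr (mul_nonneg hx.1 (Finset.sum_nonneg fun j hj => hη j ?_))
  have := (Finset.mem_Ico.mp hj).1; omega

/-- `√t ∏ (1 - η_j t)` is at most of order `(1 + ∑ η_j)^{-1/2}`. -/
lemma abs_sqrt_mul_eval_stepPoly_le (hη : ∀ j, 1 ≤ j → 0 ≤ η j) (hB : ∀ j, 1 ≤ j → η j * B ≤ 1)
    (k : ℕ) {x : ℝ} (hx : x ∈ Set.Icc 0 B) :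
    |√x * (stepPoly η T k).eval x|
      ≤ √((1 + B) / (1 + ∑ j ∈ Finset.Ico (k + 1) (T + 1), η j)) := by
  set S := ∑ j ∈ Finset.Ico (k + 1) (T + 1), η j with hS
  have hS0 : 0 ≤ S := Finset.sum_nonneg fun j hj => hη j (by
    have := (Finset.mem_Ico.mp hj).1; omega)
  have h0 := eval_stepPoly_nonneg (T := T) hη hB k hx
  have h1 := eval_stepPoly_le_exp (T := T) hη hB k hx
  rw [← hS] at h1
  refine Real.abs_le_sqrt ?_
  rw [mul_pow, Real.sq_sqrt hx.1, le_div_iff₀ (by positivity)]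
  have h2 : (stepPoly η T k).eval x ^ 2 ≤ (stepPoly η T k).eval x := by
    have := abs_eval_stepPoly_le_one (T := T) hη hB k hx
    rw [abs_of_nonneg h0] at this
    nlinarith
  have h3 : x * S * Real.exp (-(x * S)) ≤ 1 := by
    rw [Real.exp_neg, mul_inv_le_iff₀ (Real.exp_pos _), one_mul]
    linarith [Real.add_one_le_exp (x * S)]
  have h4 : Real.exp (-(x * S)) ≤ 1 := Real.exp_le_one_iff.mpr (by nlinarith [hx.1])
  calc x * (stepPoly η T k).eval x ^ 2 * (1 + S)
      ≤ x * Real.exp (-(x * S)) * (1 + S) := by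
        gcongr
        · exact hx.1
        · exact h2.trans h1
    _ = x * Real.exp (-(x * S)) + x * S * Real.exp (-(x * S)) := by ring
    _ ≤ B * 1 + 1 := by
        refine add_le_add ?_ h3
        exact mul_le_mul hx.2 h4 (Real.exp_pos _).le (hx.1.trans hx.2)
    _ = 1 + B := by ring

lemma rpow_mul_exp_neg_le {s : ℝ} (hs : 0 < s) {y : ℝ} (hy : 0 ≤ y) :
    y ^ s * Real.exp (-y) ≤ s ^ s := by
  have h1 : y / s ≤ Real.exp (y / s) := by linarith [Real.add_one_le_exp (y / s)]
  have h2 := Real.rpow_le_rpow (by positivity) h1 hs.le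
  rw [← Real.exp_mul, div_mul_cancel₀ _ hs.ne', Real.div_rpow hy hs.le,
    div_le_iff₀ (by positivity)] at h2
  rw [Real.exp_neg, mul_inv_le_iff₀ (Real.exp_pos _)]
  linarith

/-- `t ^ s ∏ (1 - η_j t) ≤ (s / ∑ η_j) ^ s`. -/
lemma abs_eval_stepPoly_mul_rpow_le (hη : ∀ j, 1 ≤ j → 0 ≤ η j) (hB : ∀ j, 1 ≤ j → η j * B ≤ 1)
    {s : ℝ} (hs : 0 < s) (hS : 0 < ∑ j ∈ Finset.Ico 1 (T + 1), η j) {x : ℝ} (hx : x ∈ Set.Icc 0 B) :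
    |(stepPoly η T 0).eval x * x ^ s| ≤ s ^ s * (∑ j ∈ Finset.Ico 1 (T + 1), η j) ^ (-s) := by
  set S := ∑ j ∈ Finset.Ico 1 (T + 1), η j
  have h0 := eval_stepPoly_nonneg (T := T) hη hB 0 hx
  have h1 := eval_stepPoly_le_exp (T := T) hη hB 0 hx
  have hxs : 0 ≤ x ^ s := Real.rpow_nonneg hx.1 s
  rw [abs_of_nonneg (mul_nonneg h0 hxs), Real.rpow_neg hS.le, ← div_eq_mul_inv,
    le_div_iff₀ (Real.rpow_pos_of_pos hS s)]
  calc (stepPoly η T 0).eval x * x ^ s * S ^ s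
      ≤ Real.exp (-(x * S)) * x ^ s * S ^ s := by gcongr
    _ = (x * S) ^ s * Real.exp (-(x * S)) := by rw [Real.mul_rpow hx.1 hS.le]; ring
    _ ≤ s ^ s := rpow_mul_exp_neg_le hs (mul_nonneg hx.1 hS.le)

/-- A gradient step followed by the propagation from `k + 1` to `T` is the propagation from `k`. -/
lemma polyCalc_stepPoly_succ_apply {𝕜 : Type*} [RCLike 𝕜] {H : Type*} [NormedAddCommGroup H]
    [InnerProductSpace 𝕜 H] (A : H →L[𝕜] H) {k : ℕ} (hk : k < T) (w : H) :
    polyCalc A (stepPoly η T (k + 1)) (w - (η (k + 1) : 𝕜) • A w)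
      = polyCalc A (stepPoly η T k) w := by
  rw [← stepPoly_succ_mul η hk, map_mul, mul_apply_eq_comp]
  congr 1
  rw [map_sub, map_mul (polyCalc A), map_one, polyCalc_C, polyCalc_X, smul_mul_assoc, one_mul,
    sub_apply, smul_apply, one_apply_eq_self]

end StepPolynomials

section ErrorBounds

open Polynomial

variable {𝕜 : Type*} [RCLike 𝕜] {X : Type*} [TopologicalSpace X]
  [MeasurableSpace X] [BorelSpace X]
  {Y : Type*} [NormedAddCommGroup Y] [InnerProductSpace 𝕜 Y] [CompleteSpace Y]
  [SecondCountableTopology Y]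
  {K : Matrix X X (Y →L[𝕜] Y)} [Fact K.PosSemidef] {κ : ℝ}

lemma integralOperator_eq [NormedSpace ℝ Y] (hK : IsBoundedMercer K κ) (μ : Measure X)
    [IsFiniteMeasure μ] : integralOperator hK μ = inclusion hK μ ∘L (inclusion hK μ).adjoint :=
  ContinuousLinearMap.copy_eq _ _ _

lemma norm_inclusion_le (hK : IsBoundedMercer K κ) (μ : Measure X) [IsProbabilityMeasure μ] :
    ‖inclusion hK μ‖ ≤ |κ| := by
  refine ContinuousLinearMap.opNorm_le_bound _ (abs_nonneg κ) fun f => ?_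
  have h := Lp.norm_le_of_ae_bound (p := 2) (μ := μ) (f := inclusion hK μ f) (C := |κ| * ‖f‖)
    (by positivity) (by
      filter_upwards [coeFn_inclusion hK μ f] with x hx
      rw [hx]
      exact hK.norm_apply_le f x)
  simpa [measureUnivNNReal] using h

lemma norm_integralOperator_le [NormedSpace ℝ Y] (hK : IsBoundedMercer K κ) (μ : Measure X)
    [IsProbabilityMeasure μ] : ‖integralOperator hK μ‖ ≤ κ ^ 2 := by
  have h := norm_inclusion_le hK μ
  calc ‖integralOperator hK μ‖ ≤ ‖inclusion hK μ‖ * ‖(inclusion hK μ).adjoint‖ := by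
        rw [integralOperator_eq]
        exact ContinuousLinearMap.opNorm_comp_le _ _
    _ ≤ |κ| * |κ| := by
        rw [LinearIsometryEquiv.norm_map]
        gcongr
    _ = κ ^ 2 := by rw [← sq, sq_abs]

variable [MeasurableSpace Y] {ρ : Measure (X × Y)} [IsProbabilityMeasure ρ]

/-- The mean square prediction error `𝔼 ‖h_{n+1} - h†‖²` after `n` steps. -/
def meanSqError (hK : IsBoundedMercer K κ) (ρ : Measure (X × Y)) [IsProbabilityMeasure ρ]
    (e : Lp Y 2 ρ.fst) (η : ℕ → ℝ) (n : ℕ) : ℝ :=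
  ∫ z : ℕ → X × Y, ‖inclusion hK ρ.fst (iterate K η z n) - e‖ ^ 2
    ∂(Measure.infinitePi fun _ : ℕ => ρ)

lemma meanSqError_nonneg (hK : IsBoundedMercer K κ) (e : Lp Y 2 ρ.fst) (η : ℕ → ℝ) (n : ℕ) :
    0 ≤ meanSqError hK ρ e η n :=
  integral_nonneg fun _ => sq_nonneg _

variable [PolishSpace X] [NormedSpace ℝ Y] [BorelSpace Y] {σ : ℝ}

/-- The sum `∑_{t=1}^T η_t² / (1 + ∑_{j=t+1}^T η_j)` that controls the contribution of the gradient
noise. -/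
def noiseSum (η : ℕ → ℝ) (T : ℕ) : ℝ :=
  ∑ k ∈ Finset.range T, η (k + 1) ^ 2 / (1 + ∑ j ∈ Finset.Ico (k + 2) (T + 1), η j)

lemma meanSqError_le_add_sum (hK : IsBoundedMercer K κ) {e : Lp Y 2 ρ.fst}
    (he : regression ρ =ᵐ[ρ.fst] e)
    (hnoise : ∫⁻ z, ‖z.2 - regression ρ z.1‖ₑ ^ 2 ∂ρ ≤ ENNReal.ofReal (σ ^ 2))
    {η : ℕ → ℝ} (hη : ∀ j, 1 ≤ j → 0 ≤ η j)
    (hB : ∀ j, 1 ≤ j → η j * ‖integralOperator hK ρ.fst‖ ≤ 1) (T : ℕ) :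
    meanSqError hK ρ e η T
      ≤ ‖polyCalc (integralOperator hK ρ.fst) (stepPoly η T 0) e‖ ^ 2
        + ∑ k ∈ Finset.range T, κ ^ 2 * (1 + κ ^ 2) *
          (η (k + 1) ^ 2 / (1 + ∑ j ∈ Finset.Ico (k + 2) (T + 1), η j)) *
            (meanSqError hK ρ e η k + σ ^ 2) := by
  have hLle := norm_integralOperator_le hK ρ.fst
  rw [integralOperator_eq] at hB hLle ⊢
  set J := inclusion hK ρ.fst with hJ
  have hstep : ∀ k < T, ∀ h : RKHS.OfKernel K,
      (polyCalc (J ∘L J.adjoint) (stepPoly η T (k + 1)) ∘L J)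
        (h - (η (k + 1) : 𝕜) • J.adjoint (J h - e))
        - polyCalc (J ∘L J.adjoint) (stepPoly η T (k + 1)) e
      = (polyCalc (J ∘L J.adjoint) (stepPoly η T k) ∘L J) h
        - polyCalc (J ∘L J.adjoint) (stepPoly η T k) e := by
    intro k hk h
    rw [ContinuousLinearMap.comp_apply, ContinuousLinearMap.comp_apply, ← map_sub, ← map_sub,
      ← polyCalc_stepPoly_succ_apply _ hk, ContinuousLinearMap.comp_apply]
    congr 1
    rw [map_sub, map_smul]
    abel
  have h := integral_iterate_le hK he hnoise
    (A := fun k => polyCalc (J ∘L J.adjoint) (stepPoly η T k) ∘L J)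
    (v := fun k => polyCalc (J ∘L J.adjoint) (stepPoly η T k) e) hstep le_rfl
  rw [stepPoly_self, map_one] at h
  refine h.trans ?_
  refine add_le_add_right (Finset.sum_le_sum fun k hk => ?_) _
  refine mul_le_mul_of_nonneg_right ?_
    (add_nonneg (meanSqError_nonneg hK e η k) (sq_nonneg σ))
  set D := 1 + ∑ j ∈ Finset.Ico (k + 2) (T + 1), η j with hD
  have hD1 : 0 < D := by
    have : 0 ≤ ∑ j ∈ Finset.Ico (k + 2) (T + 1), η j := Finset.sum_nonneg fun j hj =>
      hη j (by have := (Finset.mem_Ico.mp hj).1; omega)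
    linarith
  have hn := norm_polyCalc_comp_le J (Real.sqrt_nonneg _)
    fun x hx => abs_sqrt_mul_eval_stepPoly_le (T := T) hη hB (k + 1) hx
  have hn2 : ‖polyCalc (J ∘L J.adjoint) (stepPoly η T (k + 1)) ∘L J‖ ^ 2 ≤ (1 + κ ^ 2) / D := by
    refine (pow_le_pow_left₀ (norm_nonneg _) hn 2).trans ?_
    rw [Real.sq_sqrt (by positivity)]
    gcongr
  calc η (k + 1) ^ 2 * ‖polyCalc (J ∘L J.adjoint) (stepPoly η T (k + 1)) ∘L J‖ ^ 2 * κ ^ 2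
      ≤ η (k + 1) ^ 2 * ((1 + κ ^ 2) / D) * κ ^ 2 := by gcongr
    _ = κ ^ 2 * (1 + κ ^ 2) * (η (k + 1) ^ 2 / D) := by ring

/-- When the noise sums are small, the prediction error stays bounded along the iteration, because
the noise feeds back at most a quarter of it. -/
lemma meanSqError_le_of_noiseSum_le (hK : IsBoundedMercer K κ) {e : Lp Y 2 ρ.fst}
    (he : regression ρ =ᵐ[ρ.fst] e)
    (hnoise : ∫⁻ z, ‖z.2 - regression ρ z.1‖ₑ ^ 2 ∂ρ ≤ ENNReal.ofReal (σ ^ 2))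
    {η : ℕ → ℝ} (hη : ∀ j, 1 ≤ j → 0 ≤ η j)
    (hB : ∀ j, 1 ≤ j → η j * ‖integralOperator hK ρ.fst‖ ≤ 1) {T : ℕ}
    (hS : ∀ n ≤ T, κ ^ 2 * (1 + κ ^ 2) * noiseSum η n ≤ 1 / 4) {n : ℕ} (hn : n ≤ T) :
    meanSqError hK ρ e η n ≤ 2 * ‖e‖ ^ 2 + σ ^ 2 := by
  induction n using Nat.strong_induction_on with
  | _ n ih =>
    have hL : (integralOperator hK ρ.fst).IsPositive := by
      rw [integralOperator_eq]
      exact ContinuousLinearMap.isPositive_self_comp_adjoint _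
    have h1 : ‖polyCalc (integralOperator hK ρ.fst) (stepPoly η n 0) e‖ ^ 2 ≤ ‖e‖ ^ 2 := by
      have := norm_polyCalc_apply_le hL zero_le_one
        (fun x hx => abs_eval_stepPoly_le_one (T := n) hη hB 0 hx) e
      rw [one_mul] at this
      gcongr
    have h2 : ∑ k ∈ Finset.range n, κ ^ 2 * (1 + κ ^ 2) *
          (η (k + 1) ^ 2 / (1 + ∑ j ∈ Finset.Ico (k + 2) (n + 1), η j)) *
            (meanSqError hK ρ e η k + σ ^ 2)
        ≤ κ ^ 2 * (1 + κ ^ 2) * noiseSum η n * (2 * ‖e‖ ^ 2 + σ ^ 2 + σ ^ 2) := by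
      rw [noiseSum, Finset.mul_sum, Finset.sum_mul]
      refine Finset.sum_le_sum fun k hk => ?_
      have hk' := Finset.mem_range.mp hk
      have : 0 ≤ ∑ j ∈ Finset.Ico (k + 2) (n + 1), η j := Finset.sum_nonneg fun j hj =>
        hη j (by have := (Finset.mem_Ico.mp hj).1; omega)
      gcongr
      exact ih k hk' (hk'.le.trans hn)
    have h3 := meanSqError_le_add_sum hK he hnoise hη hB n
    have h4 := mul_le_mul_of_nonneg_right (hS n hn)
      (show 0 ≤ 2 * ‖e‖ ^ 2 + σ ^ 2 + σ ^ 2 by positivity)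
    nlinarith [sq_nonneg ‖e‖, sq_nonneg σ]

/-- The prediction error at time `T`: the error of exact gradient descent plus the noise sum. -/
lemma meanSqError_le (hK : IsBoundedMercer K κ) {e : Lp Y 2 ρ.fst}
    (he : regression ρ =ᵐ[ρ.fst] e)
    (hnoise : ∫⁻ z, ‖z.2 - regression ρ z.1‖ₑ ^ 2 ∂ρ ≤ ENNReal.ofReal (σ ^ 2))
    {η : ℕ → ℝ} (hη : ∀ j, 1 ≤ j → 0 ≤ η j)
    (hB : ∀ j, 1 ≤ j → η j * ‖integralOperator hK ρ.fst‖ ≤ 1) {T : ℕ}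
    (hS : ∀ n ≤ T, κ ^ 2 * (1 + κ ^ 2) * noiseSum η n ≤ 1 / 4) :
    meanSqError hK ρ e η T
      ≤ ‖polyCalc (integralOperator hK ρ.fst) (stepPoly η T 0) e‖ ^ 2
        + κ ^ 2 * (1 + κ ^ 2) * noiseSum η T * (2 * ‖e‖ ^ 2 + 2 * σ ^ 2) := by
  refine (meanSqError_le_add_sum hK he hnoise hη hB T).trans ?_
  rw [noiseSum, Finset.mul_sum, Finset.sum_mul]
  refine add_le_add_right (Finset.sum_le_sum fun k hk => ?_) _
  have h0 : 0 ≤ ∑ j ∈ Finset.Ico (k + 2) (T + 1), η j := Finset.sum_nonneg fun j hj =>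
    hη j (by have := (Finset.mem_Ico.mp hj).1; omega)
  have h1 := meanSqError_le_of_noiseSum_le hK he hnoise hη hB hS (Finset.mem_range.mp hk).le
  exact mul_le_mul_of_nonneg_left (by linarith) (by positivity)

/-- The prediction error under a source condition `h† = L_K ^ r g`. -/
lemma meanSqError_le_of_source (hK : IsBoundedMercer K κ) {r : ℝ} (hr : 0 < r)
    {g : Lp Y 2 ρ.fst}
    (he : regression ρ =ᵐ[ρ.fst] (opPow (integralOperator hK ρ.fst) r g : Lp Y 2 ρ.fst))
    (hnoise : ∫⁻ z, ‖z.2 - regression ρ z.1‖ₑ ^ 2 ∂ρ ≤ ENNReal.ofReal (σ ^ 2))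
    {η : ℕ → ℝ} (hη : ∀ j, 1 ≤ j → 0 ≤ η j)
    (hB : ∀ j, 1 ≤ j → η j * ‖integralOperator hK ρ.fst‖ ≤ 1) {T : ℕ}
    (hS : ∀ n ≤ T, κ ^ 2 * (1 + κ ^ 2) * noiseSum η n ≤ 1 / 4)
    (hpos : 0 < ∑ j ∈ Finset.Ico 1 (T + 1), η j) :
    meanSqError hK ρ (opPow (integralOperator hK ρ.fst) r g) η T
      ≤ (r ^ r * ‖g‖) ^ 2 * (∑ j ∈ Finset.Ico 1 (T + 1), η j) ^ (-(2 * r))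
        + κ ^ 2 * (1 + κ ^ 2) * (2 * ‖opPow (integralOperator hK ρ.fst) r g‖ ^ 2 + 2 * σ ^ 2)
          * noiseSum η T := by
  have hL : (integralOperator hK ρ.fst).IsPositive := by
    rw [integralOperator_eq]
    exact ContinuousLinearMap.isPositive_self_comp_adjoint _
  have h1 := norm_polyCalc_opPow_apply_le hL hr (by positivity)
    (fun x hx => abs_eval_stepPoly_mul_rpow_le hη hB hr hpos hx) g
  have h2 := meanSqError_le hK he hnoise hη hB hS
  have h3 := pow_le_pow_left₀ (norm_nonneg _) h1 2
  have e1 : (r ^ r * (∑ j ∈ Finset.Ico 1 (T + 1), η j) ^ (-r) * ‖g‖) ^ 2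
      = (r ^ r * ‖g‖) ^ 2 * (∑ j ∈ Finset.Ico 1 (T + 1), η j) ^ (-(2 * r)) := by
    rw [show -(2 * r) = -r * (2 : ℕ) by push_cast; ring, Real.rpow_mul_natCast hpos.le]
    ring
  rw [e1] at h3
  linarith

/-- The estimation error in the reproducing kernel Hilbert space under a source condition with
`r > 1/2`. -/
lemma exists_integral_norm_iterate_sub_sq_le (hK : IsBoundedMercer K κ) {r : ℝ} (hr : 1 / 2 < r)
    {g : Lp Y 2 ρ.fst}
    (he : regression ρ =ᵐ[ρ.fst] (opPow (integralOperator hK ρ.fst) r g : Lp Y 2 ρ.fst))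
    (hnoise : ∫⁻ z, ‖z.2 - regression ρ z.1‖ₑ ^ 2 ∂ρ ≤ ENNReal.ofReal (σ ^ 2)) :
    ∃ u : RKHS.OfKernel K, (u : X → Y) =ᵐ[ρ.fst] regression ρ ∧
      ∀ {η : ℕ → ℝ} {T : ℕ}, (∀ j, 1 ≤ j → 0 ≤ η j) →
        (∀ j, 1 ≤ j → η j * ‖integralOperator hK ρ.fst‖ ≤ 1) →
        (∀ n ≤ T, κ ^ 2 * (1 + κ ^ 2) * noiseSum η n ≤ 1 / 4) →
        0 < ∑ j ∈ Finset.Ico 1 (T + 1), η j →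
        Integrable (fun z : ℕ → X × Y => ‖iterate K η z T - u‖ ^ 2)
          (Measure.infinitePi fun _ : ℕ => ρ) ∧
        ∫ z : ℕ → X × Y, ‖iterate K η z T - u‖ ^ 2 ∂(Measure.infinitePi fun _ : ℕ => ρ)
          ≤ ((r - 1 / 2) ^ (r - 1 / 2) * ‖g‖) ^ 2
              * (∑ j ∈ Finset.Ico 1 (T + 1), η j) ^ (-(2 * r - 1))
            + κ ^ 2 * (2 * ‖opPow (integralOperator hK ρ.fst) r g‖ ^ 2 + 2 * σ ^ 2)
              * ∑ j ∈ Finset.Ico 1 (T + 1), η j ^ 2 := by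
  obtain ⟨u, hu, hq⟩ := exists_preimage_opPow (inclusion hK ρ.fst) hr g
  rw [← integralOperator_eq] at hu hq
  refine ⟨u, ?_, fun {η T} hη hB hS hpos => ?_⟩
  · filter_upwards [coeFn_inclusion hK ρ.fst u, he] with x h1 h2
    rw [h2, ← h1, hu]
  set e := opPow (integralOperator hK ρ.fst) r g with he'
  set J := inclusion hK ρ.fst with hJ
  refine ⟨integrable_norm_iterate_sub_sq hK he hnoise (ContinuousLinearMap.id 𝕜 _) u η T, ?_⟩
  have hCpos : (J.adjoint ∘L J).IsPositive := ContinuousLinearMap.isPositive_adjoint_comp_self J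
  have hCnorm : ‖J.adjoint ∘L J‖ = ‖integralOperator hK ρ.fst‖ := by
    rw [integralOperator_eq, norm_adjoint_comp_self_eq_norm_self_comp_adjoint]
  have hstep : ∀ k < T, ∀ h : RKHS.OfKernel K,
      polyCalc (J.adjoint ∘L J) (stepPoly η T (k + 1))
        (h - (η (k + 1) : 𝕜) • J.adjoint (J h - e))
        - polyCalc (J.adjoint ∘L J) (stepPoly η T (k + 1)) u
      = polyCalc (J.adjoint ∘L J) (stepPoly η T k) h
        - polyCalc (J.adjoint ∘L J) (stepPoly η T k) u := by
    intro k hk h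
    rw [← map_sub, ← map_sub, ← polyCalc_stepPoly_succ_apply _ hk,
      ContinuousLinearMap.comp_apply, map_sub J, hu]
    congr 1
    abel
  have h := integral_iterate_le hK he hnoise
    (A := fun k => polyCalc (J.adjoint ∘L J) (stepPoly η T k))
    (v := fun k => polyCalc (J.adjoint ∘L J) (stepPoly η T k) u) hstep le_rfl
  rw [stepPoly_self, map_one] at h
  refine h.trans (add_le_add ?_ ?_)
  · have h1 := hq (stepPoly η T 0) _ (by positivity)
      (fun x hx => abs_eval_stepPoly_mul_rpow_le (s := r - 1 / 2) hη hB (by linarith) hpos hx)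
    refine (pow_le_pow_left₀ (norm_nonneg _) h1 2).trans_eq ?_
    rw [show -(2 * r - 1) = -(r - 1 / 2) * (2 : ℕ) by push_cast; ring,
      Real.rpow_mul_natCast hpos.le]
    ring
  · rw [Finset.mul_sum, Finset.sum_Ico_eq_sum_range]
    refine Finset.sum_le_sum fun k hk => ?_
    have hk' : k < T := Finset.mem_range.mp hk
    have hA : ‖polyCalc (J.adjoint ∘L J) (stepPoly η T (k + 1))‖ ≤ 1 :=
      norm_polyCalc_le hCpos zero_le_one fun x hx =>
        abs_eval_stepPoly_le_one hη hB (k + 1) (by rwa [hCnorm] at hx)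
    have hM := meanSqError_le_of_noiseSum_le hK he hnoise hη hB hS hk'.le
    have hA2 : ‖polyCalc (J.adjoint ∘L J) (stepPoly η T (k + 1))‖ ^ 2 ≤ 1 :=
      pow_le_one₀ (norm_nonneg _) hA
    have hM0 := meanSqError_nonneg hK (ρ := ρ) e η k
    rw [add_comm 1 k]
    change _ * (meanSqError hK ρ e η k + σ ^ 2) ≤ _
    calc η (k + 1) ^ 2 * ‖polyCalc (J.adjoint ∘L J) (stepPoly η T (k + 1))‖ ^ 2 * κ ^ 2 *
          (meanSqError hK ρ e η k + σ ^ 2)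
        ≤ η (k + 1) ^ 2 * 1 * κ ^ 2 * (2 * ‖e‖ ^ 2 + σ ^ 2 + σ ^ 2) := by gcongr
      _ = κ ^ 2 * (2 * ‖e‖ ^ 2 + 2 * σ ^ 2) * η (k + 1) ^ 2 := by ring

end ErrorBounds

/-! ### Step-size sums -/

section PowerSums

lemma sum_range_inv_le (n : ℕ) :
    ∑ k ∈ Finset.range n, 1 / ((k : ℝ) + 1) ≤ 1 + Real.log n := by
  have h := harmonic_le_one_add_log n
  rw [harmonic] at h
  push_cast at h
  simpa [one_div] using h

lemma sum_Ico_inv_le (T : ℕ) : ∑ t ∈ Finset.Ico 1 (T + 1), 1 / (t : ℝ) ≤ 1 + Real.log T := by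
  rw [Finset.sum_Ico_eq_sum_range]
  refine le_of_eq_of_le (Finset.sum_congr rfl fun k _ => ?_) (sum_range_inv_le T)
  push_cast
  rw [add_comm]

lemma sum_Ico_inv_reflect_le (T : ℕ) :
    ∑ t ∈ Finset.Ico 1 (T + 1), 1 / ((T : ℝ) + 1 - t) ≤ 1 + Real.log T := by
  rw [Finset.sum_Ico_eq_sum_range, Nat.add_sub_cancel,
    ← Finset.sum_range_reflect (fun k => 1 / ((T : ℝ) + 1 - ((1 + k : ℕ) : ℝ)))]
  refine le_of_eq_of_le (Finset.sum_congr rfl fun k hk => ?_) (sum_range_inv_le T)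
  have hk' : k < T := Finset.mem_range.mp hk
  have e : ((T - 1 - k : ℕ) : ℝ) = (T : ℝ) - 1 - k := by
    rw [Nat.cast_sub (by omega), Nat.cast_sub (by omega)]
    simp
  push_cast [e]
  congr 1
  ring

/-- The partial fraction decomposition behind the convolution estimates below. -/
lemma rpow_neg_div_eq {a t N : ℝ} (ht : 0 < t) (htN : t < N) :
    t ^ (-a) / (N - t) = t ^ (1 - a) / N * (1 / t + 1 / (N - t)) := by
  have h1 : N - t ≠ 0 := (sub_pos.mpr htN).ne'
  have h2 : N ≠ 0 := (ht.trans htN).ne'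
  rw [show (1 - a) = 1 + -a by ring, Real.rpow_add ht, Real.rpow_one]
  field_simp
  ring

/-- For `a ≤ 1` the discrete convolution of `t ^ (-a)` and `1 / t` is of order
`T ^ (-a) log T`. -/
lemma sum_rpow_neg_div_le {a : ℝ} (ha : a ≤ 1) {T : ℕ} (hT : 1 ≤ T) :
    ∑ t ∈ Finset.Ico 1 (T + 1), (t : ℝ) ^ (-a) / ((T : ℝ) + 1 - t)
      ≤ 2 * (T : ℝ) ^ (-a) * (1 + Real.log T) := by
  have hT0 : (0 : ℝ) < T := by exact_mod_cast hT
  have h : ∀ t ∈ Finset.Ico 1 (T + 1), (t : ℝ) ^ (-a) / ((T : ℝ) + 1 - t)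
      ≤ (T : ℝ) ^ (-a) * (1 / (t : ℝ) + 1 / ((T : ℝ) + 1 - t)) := by
    intro t ht
    obtain ⟨h1, h2⟩ := Finset.mem_Ico.mp ht
    have ht0 : (0 : ℝ) < t := by exact_mod_cast h1
    have htT : (t : ℝ) ≤ T := by exact_mod_cast Nat.lt_succ_iff.mp h2
    have hd : (0 : ℝ) < (T : ℝ) + 1 - t := by linarith
    rw [rpow_neg_div_eq ht0 (by linarith : (t : ℝ) < (T : ℝ) + 1)]
    refine mul_le_mul_of_nonneg_right ?_ (by positivity)
    rw [div_le_iff₀ (by positivity)]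
    calc (t : ℝ) ^ (1 - a) ≤ (T : ℝ) ^ (1 - a) := by
          exact Real.rpow_le_rpow ht0.le htT (by linarith)
      _ = (T : ℝ) ^ (-a) * T := by
          rw [show (1 - a) = -a + 1 by ring, Real.rpow_add hT0, Real.rpow_one]
      _ ≤ (T : ℝ) ^ (-a) * (T + 1) := by gcongr; linarith
  refine (Finset.sum_le_sum h).trans ?_
  rw [← Finset.mul_sum, Finset.sum_add_distrib]
  have h1 := sum_Ico_inv_le T
  have h2 := sum_Ico_inv_reflect_le T
  have h3 : 0 ≤ (T : ℝ) ^ (-a) := by positivity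
  nlinarith

lemma rpow_neg_mul_log_le {d N : ℝ} (hd : 0 < d) (hN : 0 < N) :
    N ^ (-d) * Real.log N ≤ 1 / d := by
  have h := Real.log_le_rpow_div hN.le hd
  rw [Real.rpow_neg hN.le, inv_mul_le_iff₀ (by positivity)]
  calc Real.log N ≤ N ^ d / d := h
    _ = N ^ d * (1 / d) := by ring

/-- For `1 < a ≤ 2` the discrete convolution of `t ^ (-a)` and `1 / t` is of order `1 / T`. -/
lemma exists_sum_rpow_neg_div_le {a : ℝ} (ha : 1 < a) (ha2 : a ≤ 2) :
    ∃ M : ℝ, 0 ≤ M ∧ ∀ T : ℕ, 1 ≤ T →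
      ∑ t ∈ Finset.Ico 1 (T + 1), (t : ℝ) ^ (-a) / ((T : ℝ) + 1 - t) ≤ M / ((T : ℝ) + 1) := by
  have hsum : Summable fun t : ℕ => (t : ℝ) ^ (-a) := Real.summable_nat_rpow.mpr (by linarith)
  have hZ : 0 ≤ ∑' t : ℕ, (t : ℝ) ^ (-a) := tsum_nonneg fun t => by positivity
  refine ⟨∑' t : ℕ, (t : ℝ) ^ (-a) + 2 * (1 + 1 / (a - 1)), ?_, fun T hT => ?_⟩
  · have : 0 < a - 1 := by linarith
    positivity
  have hT0 : (0 : ℝ) < T := by exact_mod_cast hT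
  have hT1 : (1 : ℝ) ≤ T := by exact_mod_cast hT
  have h : ∀ t ∈ Finset.Ico 1 (T + 1), (t : ℝ) ^ (-a) / ((T : ℝ) + 1 - t)
      = ((t : ℝ) ^ (-a) + (t : ℝ) ^ (-(a - 1)) / ((T : ℝ) + 1 - t)) / ((T : ℝ) + 1) := by
    intro t ht
    obtain ⟨h1, h2⟩ := Finset.mem_Ico.mp ht
    have ht0 : (0 : ℝ) < t := by exact_mod_cast h1
    have htT : (t : ℝ) ≤ T := by exact_mod_cast Nat.lt_succ_iff.mp h2
    rw [rpow_neg_div_eq ht0 (by linarith : (t : ℝ) < (T : ℝ) + 1)]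
    have e : (t : ℝ) ^ (-a) = (t : ℝ) ^ (1 - a) * (1 / t) := by
      rw [show (-a) = (1 - a) + (-1) by ring, Real.rpow_add ht0, Real.rpow_neg_one, one_div]
    rw [e, show -(a - 1) = 1 - a by ring]
    ring
  rw [Finset.sum_congr rfl h, ← Finset.sum_div, Finset.sum_add_distrib]
  gcongr
  · exact hsum.sum_le_tsum _ fun t _ => by positivity
  · refine (sum_rpow_neg_div_le (a := a - 1) (by linarith) hT).trans ?_
    have h1 := rpow_neg_mul_log_le (d := a - 1) (by linarith) hT0
    have h2 : (T : ℝ) ^ (-(a - 1)) ≤ 1 :=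
      Real.rpow_le_one_of_one_le_of_nonpos hT1 (by linarith)
    nlinarith

lemma rpow_neg_le_two_rpow_mul {p : ℝ} (hp : 0 ≤ p) {T : ℕ} (hT : 1 ≤ T) :
    (T : ℝ) ^ (-p) ≤ 2 ^ p * ((T : ℝ) + 1) ^ (-p) := by
  have hT1 : (1 : ℝ) ≤ T := by exact_mod_cast hT
  have h : ((T : ℝ) + 1) ^ p ≤ 2 ^ p * (T : ℝ) ^ p := by
    rw [← Real.mul_rpow (by norm_num) (by positivity)]
    exact Real.rpow_le_rpow (by positivity) (by linarith) hp
  rw [Real.rpow_neg (by positivity), Real.rpow_neg (by positivity), ← div_eq_mul_inv,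
    le_div_iff₀ (by positivity), inv_mul_le_iff₀ (by positivity)]
  linarith

lemma one_le_two_mul_log {T : ℕ} (hT : 1 ≤ T) : 1 ≤ 2 * Real.log ((T : ℝ) + 1) := by
  have hT1 : (1 : ℝ) ≤ T := by exact_mod_cast hT
  have h1 : Real.log 2 ≤ Real.log ((T : ℝ) + 1) := Real.log_le_log (by norm_num) (by linarith)
  linarith [Real.log_two_gt_d9]

lemma one_add_log_le {T : ℕ} (hT : 1 ≤ T) : 1 + Real.log T ≤ 3 * Real.log ((T : ℝ) + 1) := by
  have hT1 : (1 : ℝ) ≤ T := by exact_mod_cast hT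
  have h1 := one_le_two_mul_log hT
  have h2 : Real.log T ≤ Real.log ((T : ℝ) + 1) := Real.log_le_log (by linarith) (by linarith)
  linarith

end PowerSums

section StepSumConst

/-- The rate in the defining inequality of `stepSumConst`. -/
def stepSumRate (θ : ℝ) (T : ℕ) : ℝ :=
  if θ ≤ 1 / 2 then ((T : ℝ) + 1) ^ (-θ) * Real.log ((T : ℝ) + 1)
  else ((T : ℝ) + 1) ^ (-(1 - θ))

lemma stepSumRate_pos (θ : ℝ) {T : ℕ} (hT : 1 ≤ T) : 0 < stepSumRate θ T := by
  have h := one_le_two_mul_log hT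
  have h' : 0 < Real.log ((T : ℝ) + 1) := by linarith
  rw [stepSumRate]
  split_ifs <;> positivity

lemma mul_le_one_add_sum_rpow {θ : ℝ} (hθ : 0 ≤ θ) {t T : ℕ} (ht : t ≤ T) (hT : 1 ≤ T) :
    (T : ℝ) ^ (-θ) * ((T : ℝ) + 1 - t) ≤ 1 + ∑ j ∈ Finset.Icc (t + 1) T, (j : ℝ) ^ (-θ) := by
  have hT1 : (1 : ℝ) ≤ T := by exact_mod_cast hT
  have h1 : (T : ℝ) ^ (-θ) ≤ 1 := Real.rpow_le_one_of_one_le_of_nonpos hT1 (by linarith)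
  have h2 : (Finset.Icc (t + 1) T).card • (T : ℝ) ^ (-θ)
      ≤ ∑ j ∈ Finset.Icc (t + 1) T, (j : ℝ) ^ (-θ) := by
    refine Finset.card_nsmul_le_sum _ _ _ fun j hj => ?_
    obtain ⟨h3, h4⟩ := Finset.mem_Icc.mp hj
    exact Real.rpow_le_rpow_of_nonpos (by exact_mod_cast (by omega : 0 < j))
      (by exact_mod_cast h4) (by linarith)
  rw [Nat.card_Icc, nsmul_eq_mul, Nat.cast_sub (by omega)] at h2
  push_cast at h2
  nlinarith

/-- The sum estimate for the step sizes holds with some constant, so that the infimum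
`stepSumConst θ` is meaningful. -/
lemma exists_isStepSumConst {θ : ℝ} (hθ : 0 < θ) (hθ1 : θ < 1) : ∃ δ : ℝ, IsStepSumConst θ δ := by
  have key : ∃ M : ℝ, 0 ≤ M ∧ ∀ T : ℕ, 1 ≤ T → (T : ℝ) ^ θ *
      ∑ t ∈ Finset.Ico 1 (T + 1), (t : ℝ) ^ (-(2 * θ)) / ((T : ℝ) + 1 - t)
        ≤ M * stepSumRate θ T := by
    rcases le_or_gt θ (1 / 2) with h | h
    · refine ⟨12, by norm_num, fun T hT => ?_⟩
      have hT0 : (0 : ℝ) < T := by exact_mod_cast hT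
      have h1 := sum_rpow_neg_div_le (a := 2 * θ) (by linarith) hT
      have h2 := one_add_log_le hT
      have h3 := rpow_neg_le_two_rpow_mul hθ.le hT
      have h4 : (2 : ℝ) ^ θ ≤ 2 := by
        calc (2 : ℝ) ^ θ ≤ 2 ^ (1 : ℝ) := Real.rpow_le_rpow_of_exponent_le (by norm_num) hθ1.le
          _ = 2 := Real.rpow_one 2
      have h5 : 0 ≤ Real.log ((T : ℝ) + 1) := by linarith [one_le_two_mul_log hT]
      rw [stepSumRate, if_pos h]
      calc (T : ℝ) ^ θ * ∑ t ∈ Finset.Ico 1 (T + 1), (t : ℝ) ^ (-(2 * θ)) / ((T : ℝ) + 1 - t)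
          ≤ (T : ℝ) ^ θ * (2 * (T : ℝ) ^ (-(2 * θ)) * (1 + Real.log T)) := by gcongr
        _ = 2 * (T : ℝ) ^ (-θ) * (1 + Real.log T) := by
            rw [show -θ = θ + -(2 * θ) by ring, Real.rpow_add hT0]; ring
        _ ≤ 2 * (2 * ((T : ℝ) + 1) ^ (-θ)) * (3 * Real.log ((T : ℝ) + 1)) := by
            gcongr
            exact h3.trans (by gcongr)
        _ = 12 * (((T : ℝ) + 1) ^ (-θ) * Real.log ((T : ℝ) + 1)) := by ring
    · obtain ⟨M, hM, hMT⟩ := exists_sum_rpow_neg_div_le (a := 2 * θ) (by linarith) (by linarith)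
      refine ⟨M, hM, fun T hT => ?_⟩
      have hT0 : (0 : ℝ) < T := by exact_mod_cast hT
      rw [stepSumRate, if_neg (not_le.mpr h)]
      calc (T : ℝ) ^ θ * ∑ t ∈ Finset.Ico 1 (T + 1), (t : ℝ) ^ (-(2 * θ)) / ((T : ℝ) + 1 - t)
          ≤ ((T : ℝ) + 1) ^ θ * (M / ((T : ℝ) + 1)) := by
            refine (mul_le_mul_of_nonneg_left (hMT T hT) (by positivity)).trans ?_
            gcongr
            linarith
        _ = M * ((T : ℝ) + 1) ^ (-(1 - θ)) := by
            rw [show -(1 - θ) = θ - 1 by ring, Real.rpow_sub_one (by positivity)]; ring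
  obtain ⟨M, hM, hMT⟩ := key
  have hθ' : 0 < 1 - θ := by linarith
  refine ⟨M / (1 - θ), fun T hT η₁ hη => ?_⟩
  have hT0 : (0 : ℝ) < T := by exact_mod_cast (by omega : 0 < T)
  have hm : 0 < min 1 (η₁ / (1 - θ)) := lt_min one_pos (by positivity)
  have hm1 : min 1 (η₁ / (1 - θ)) * (1 - θ) ≤ 1 := by
    have := min_le_left 1 (η₁ / (1 - θ))
    nlinarith
  have hm2 : min 1 (η₁ / (1 - θ)) * (1 - θ) ≤ η₁ :=
    (le_div_iff₀ hθ').mp (min_le_right 1 (η₁ / (1 - θ)))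
  set m := min 1 (η₁ / (1 - θ))
  have hterm : ∀ t ∈ Finset.Ico 1 T, (η₁ * (t : ℝ) ^ (-θ)) ^ 2 /
        (1 + ∑ j ∈ Finset.Icc (t + 1) T, η₁ * (j : ℝ) ^ (-θ))
      ≤ η₁ ^ 2 / m / (1 - θ) * ((T : ℝ) ^ θ * ((t : ℝ) ^ (-(2 * θ)) / ((T : ℝ) + 1 - t))) := by
    intro t ht
    obtain ⟨h1, h2⟩ := Finset.mem_Ico.mp ht
    have ht0 : (0 : ℝ) < t := by exact_mod_cast h1
    have htT : (t : ℝ) ≤ T := by exact_mod_cast h2.le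
    have hd : (0 : ℝ) < (T : ℝ) + 1 - t := by linarith
    have hs : 0 ≤ ∑ j ∈ Finset.Icc (t + 1) T, (j : ℝ) ^ (-θ) :=
      Finset.sum_nonneg fun j _ => by positivity
    have hden : m * (1 - θ) * ((T : ℝ) ^ (-θ) * ((T : ℝ) + 1 - t))
        ≤ 1 + ∑ j ∈ Finset.Icc (t + 1) T, η₁ * (j : ℝ) ^ (-θ) := by
      rw [← Finset.mul_sum]
      have h3 := mul_le_one_add_sum_rpow hθ.le h2.le (by omega : 1 ≤ T)
      have h4 : 0 ≤ m * (1 - θ) := by positivity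
      nlinarith
    calc (η₁ * (t : ℝ) ^ (-θ)) ^ 2 / (1 + ∑ j ∈ Finset.Icc (t + 1) T, η₁ * (j : ℝ) ^ (-θ))
        ≤ (η₁ * (t : ℝ) ^ (-θ)) ^ 2 / (m * (1 - θ) * ((T : ℝ) ^ (-θ) * ((T : ℝ) + 1 - t))) := by
          gcongr
      _ = _ := by
          rw [mul_pow, ← Real.rpow_mul_natCast ht0.le, Real.rpow_neg hT0.le,
            show -θ * (2 : ℕ) = -(2 * θ) by push_cast; ring]
          field_simp
  refine (Finset.sum_le_sum hterm).trans ?_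
  rw [← Finset.mul_sum, ← Finset.mul_sum]
  have hsub : ∑ t ∈ Finset.Ico 1 T, (t : ℝ) ^ (-(2 * θ)) / ((T : ℝ) + 1 - t)
      ≤ ∑ t ∈ Finset.Ico 1 (T + 1), (t : ℝ) ^ (-(2 * θ)) / ((T : ℝ) + 1 - t) := by
    refine Finset.sum_le_sum_of_subset_of_nonneg
      (Finset.Ico_subset_Ico_right (Nat.le_succ T)) fun t ht _ => ?_
    have htT : (t : ℝ) ≤ T := by exact_mod_cast Nat.lt_succ_iff.mp (Finset.mem_Ico.mp ht).2
    exact div_nonneg (by positivity) (by linarith)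
  change _ ≤ M / (1 - θ) * (η₁ ^ 2 / m) * stepSumRate θ T
  calc η₁ ^ 2 / m / (1 - θ) *
        ((T : ℝ) ^ θ * ∑ t ∈ Finset.Ico 1 T, (t : ℝ) ^ (-(2 * θ)) / ((T : ℝ) + 1 - t))
      ≤ η₁ ^ 2 / m / (1 - θ) * (M * stepSumRate θ T) := by
        refine mul_le_mul_of_nonneg_left ?_ (by positivity)
        exact (mul_le_mul_of_nonneg_left hsub (by positivity)).trans (hMT T (by omega))
    _ = _ := by ring

lemma IsStepSumConst.div_le {θ : ℝ} (hθ1 : θ < 1) {δ : ℝ} (hδ : IsStepSumConst θ δ) {T : ℕ}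
    (hT : 2 ≤ T) {η₁ : ℝ} (hη : 0 < η₁) :
    (∑ t ∈ Finset.Ico 1 T, (η₁ * (t : ℝ) ^ (-θ)) ^ 2 /
        (1 + ∑ j ∈ Finset.Icc (t + 1) T, η₁ * (j : ℝ) ^ (-θ))) /
      (η₁ ^ 2 / min 1 (η₁ / (1 - θ)) * stepSumRate θ T) ≤ δ := by
  have hR := stepSumRate_pos θ (by omega : 1 ≤ T)
  have h1 : 0 < 1 - θ := by linarith
  have hm : 0 < min 1 (η₁ / (1 - θ)) := lt_min one_pos (by positivity)
  rw [div_le_iff₀ (by positivity), ← mul_assoc]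
  exact hδ T hT η₁ hη

lemma isStepSumConst_stepSumConst {θ : ℝ} (hθ : 0 < θ) (hθ1 : θ < 1) :
    IsStepSumConst θ (stepSumConst θ) := by
  intro T hT η₁ hη
  have hR := stepSumRate_pos θ (by omega : 1 ≤ T)
  have h1 : 0 < 1 - θ := by linarith
  have hm : 0 < min 1 (η₁ / (1 - θ)) := lt_min one_pos (by positivity)
  have h := le_csInf (exists_isStepSumConst hθ hθ1) fun δ hδ =>
    IsStepSumConst.div_le hθ1 hδ hT hη
  rw [div_le_iff₀ (by positivity), ← mul_assoc] at h
  exact h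

lemma stepSumConst_nonneg {θ : ℝ} (hθ1 : θ < 1) : 0 ≤ stepSumConst θ := by
  refine Real.sInf_nonneg fun δ hδ => ?_
  refine le_trans ?_ (IsStepSumConst.div_le hθ1 hδ le_rfl one_pos)
  have hR := stepSumRate_pos θ (by norm_num : 1 ≤ 2)
  have h1 : 0 < 1 - θ := by linarith
  have hm : 0 < min 1 (1 / (1 - θ)) := lt_min one_pos (by positivity)
  refine div_nonneg (Finset.sum_nonneg fun t _ => ?_) (by positivity)
  have : 0 ≤ ∑ j ∈ Finset.Icc (t + 1) 2, 1 * (j : ℝ) ^ (-θ) :=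
    Finset.sum_nonneg fun j _ => by positivity
  positivity

lemma stepSumRate_le {θ : ℝ} (hθ : 0 < θ) (hθ1 : θ < 1) (T : ℕ) : stepSumRate θ T ≤ 1 / θ := by
  have hN : (1 : ℝ) ≤ (T : ℝ) + 1 := by linarith [Nat.cast_nonneg (α := ℝ) T]
  rw [stepSumRate]
  split_ifs with h
  · exact rpow_neg_mul_log_le hθ (by linarith)
  · refine (Real.rpow_le_one_of_one_le_of_nonpos hN (by linarith)).trans ?_
    rw [le_div_iff₀ hθ]
    linarith

end StepSumConst

section NoiseSums

/-- The noise sum for the decaying step sizes `η₁ t ^ (-θ)`. -/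
lemma noiseSum_decaying_le {θ : ℝ} (hθ : 0 < θ) (hθ1 : θ < 1) {η₁ : ℝ} (hη : 0 < η₁)
    (hη1 : η₁ < 1 - θ) {T : ℕ} (hT : 1 ≤ T) :
    noiseSum (fun t => η₁ * (t : ℝ) ^ (-θ)) T
      ≤ η₁ * (stepSumConst θ * stepSumRate θ T + (T : ℝ) ^ (-(2 * θ))) := by
  have hT0 : (0 : ℝ) < T := by exact_mod_cast hT
  have hδ := stepSumConst_nonneg hθ1
  have hR := stepSumRate_pos θ hT
  obtain ⟨n, rfl⟩ : ∃ n, T = n + 1 := ⟨T - 1, by omega⟩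
  rw [noiseSum, Finset.sum_range_succ]
  have hlast : (η₁ * ((n + 1 : ℕ) : ℝ) ^ (-θ)) ^ 2 /
      (1 + ∑ j ∈ Finset.Ico (n + 2) (n + 1 + 1), η₁ * (j : ℝ) ^ (-θ))
        ≤ η₁ * ((n + 1 : ℕ) : ℝ) ^ (-(2 * θ)) := by
    rw [Finset.Ico_self, Finset.sum_empty, add_zero, div_one, mul_pow,
      ← Real.rpow_mul_natCast hT0.le, show -θ * (2 : ℕ) = -(2 * θ) by push_cast; ring]
    gcongr
    nlinarith
  have hmain : ∑ k ∈ Finset.range n, (η₁ * ((k + 1 : ℕ) : ℝ) ^ (-θ)) ^ 2 /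
      (1 + ∑ j ∈ Finset.Ico (k + 2) (n + 1 + 1), η₁ * (j : ℝ) ^ (-θ))
        ≤ η₁ * (stepSumConst θ * stepSumRate θ (n + 1)) := by
    rcases Nat.eq_zero_or_pos n with rfl | hn
    · rw [Finset.range_zero, Finset.sum_empty]
      positivity
    have h := isStepSumConst_stepSumConst hθ hθ1 (n + 1) (by omega) η₁ hη
    have hmin : η₁ ^ 2 / min 1 (η₁ / (1 - θ)) = η₁ * (1 - θ) := by
      have h1 : 0 < 1 - θ := by linarith
      rw [min_eq_right ((div_le_one h1).mpr hη1.le)]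
      field_simp
    rw [hmin, Finset.sum_Ico_eq_sum_range] at h
    have e : ∑ k ∈ Finset.range n, (η₁ * ((k + 1 : ℕ) : ℝ) ^ (-θ)) ^ 2 /
        (1 + ∑ j ∈ Finset.Ico (k + 2) (n + 1 + 1), η₁ * (j : ℝ) ^ (-θ))
        = ∑ k ∈ Finset.range (n + 1 - 1), (η₁ * ((1 + k : ℕ) : ℝ) ^ (-θ)) ^ 2 /
          (1 + ∑ j ∈ Finset.Icc (1 + k + 1) (n + 1), η₁ * (j : ℝ) ^ (-θ)) := by
      refine Finset.sum_congr rfl fun k _ => ?_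
      rw [add_comm 1 k]
      rfl
    rw [e]
    refine h.trans ?_
    change stepSumConst θ * (η₁ * (1 - θ)) * stepSumRate θ (n + 1) ≤ _
    have h3 : 0 ≤ stepSumConst θ * stepSumRate θ (n + 1) * η₁ := by positivity
    nlinarith
  rw [mul_add]
  exact add_le_add hmain hlast

/-- The noise sum for constant step sizes. -/
lemma noiseSum_const_le {η : ℝ} (hη : 0 ≤ η) (hη1 : η ≤ 1) {n T : ℕ} (hn : n ≤ T)
    (hT : 1 ≤ T) : noiseSum (fun _ => η) n ≤ η * (1 + Real.log T) := by
  have hT1 : (1 : ℝ) ≤ T := by exact_mod_cast hT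
  have h1 : noiseSum (fun _ => η) n ≤ η * ∑ k ∈ Finset.range n, 1 / ((k : ℝ) + 1) := by
    rw [noiseSum, ← Finset.sum_range_reflect (fun k => 1 / ((k : ℝ) + 1)), Finset.mul_sum]
    refine Finset.sum_le_sum fun k hk => ?_
    rw [Finset.sum_const, Nat.card_Ico, nsmul_eq_mul,
      show n + 1 - (k + 2) = n - 1 - k by omega]
    have hm : (0 : ℝ) ≤ ((n - 1 - k : ℕ) : ℝ) := Nat.cast_nonneg _
    rw [mul_one_div, div_le_div_iff₀ (by positivity) (by positivity)]
    nlinarith [mul_nonneg hη (mul_nonneg hm hη), mul_nonneg hη (sub_nonneg.mpr hη1)]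
  refine h1.trans (mul_le_mul_of_nonneg_left ?_ hη)
  calc ∑ k ∈ Finset.range n, 1 / ((k : ℝ) + 1) ≤ ∑ k ∈ Finset.range T, 1 / ((k : ℝ) + 1) :=
        Finset.sum_le_sum_of_subset_of_nonneg (Finset.range_subset_range.mpr hn)
          fun k _ _ => by positivity
    _ ≤ 1 + Real.log T := sum_range_inv_le T

end NoiseSums

section Rates

/-- `N ^ (-min(a, b))` is dominated by the rate `N ^ (-a) log N` (`a ≤ b`), `N ^ (-b)` (`b < a`). -/
lemma rpow_neg_le_rate {a b c : ℝ} {T : ℕ} (hT : 1 ≤ T) (hc : min a b ≤ c) :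
    ((T : ℝ) + 1) ^ (-c) ≤ 2 * (if a ≤ b then ((T : ℝ) + 1) ^ (-a) * Real.log ((T : ℝ) + 1)
      else ((T : ℝ) + 1) ^ (-b)) := by
  have hN : (1 : ℝ) ≤ (T : ℝ) + 1 := by linarith [Nat.cast_nonneg (α := ℝ) T]
  have hl := one_le_two_mul_log hT
  split_ifs with h
  · rw [min_eq_left h] at hc
    have h1 : ((T : ℝ) + 1) ^ (-c) ≤ ((T : ℝ) + 1) ^ (-a) :=
      Real.rpow_le_rpow_of_exponent_le hN (by linarith)
    have h2 : 0 < ((T : ℝ) + 1) ^ (-a) := by positivity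
    nlinarith
  · rw [min_eq_right (not_le.mp h).le] at hc
    have h1 : ((T : ℝ) + 1) ^ (-c) ≤ ((T : ℝ) + 1) ^ (-b) :=
      Real.rpow_le_rpow_of_exponent_le hN (by linarith)
    have h2 : 0 < ((T : ℝ) + 1) ^ (-b) := by positivity
    linarith

/-- A logarithm is absorbed by the power `N ^ (a - b)` if `b < a`.  In the case `a = b` the first
branch applies, and the convention `1 / 0 = 0` is harmless. -/
lemma rpow_neg_mul_log_le_rate (a b : ℝ) {T : ℕ} (hT : 1 ≤ T) :
    ((T : ℝ) + 1) ^ (-a) * Real.log ((T : ℝ) + 1)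
      ≤ (1 + 1 / |a - b|) * (if a ≤ b then ((T : ℝ) + 1) ^ (-a) * Real.log ((T : ℝ) + 1)
        else ((T : ℝ) + 1) ^ (-b)) := by
  have hN : (0 : ℝ) < (T : ℝ) + 1 := by positivity
  have hl : 0 < Real.log ((T : ℝ) + 1) := by linarith [one_le_two_mul_log hT]
  have h0 : 0 ≤ 1 / |a - b| := by positivity
  split_ifs with h
  · have h2 : 0 < ((T : ℝ) + 1) ^ (-a) * Real.log ((T : ℝ) + 1) := by positivity
    nlinarith
  · have hd : 0 < a - b := by linarith [not_le.mp h]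
    have h1 := rpow_neg_mul_log_le hd hN
    have h2 : 0 < ((T : ℝ) + 1) ^ (-b) := by positivity
    rw [abs_of_pos hd, show -a = -b + -(a - b) by ring, Real.rpow_add hN]
    nlinarith

lemma le_div_one_add_iff {a m : ℝ} (hm : 0 < m) : a ≤ m / (1 + m) ↔ a ≤ m * (1 - a) := by
  rw [le_div_iff₀ (by positivity)]
  constructor <;> intro h <;> linarith

lemma mul_rpow_le_sum_Ico {θ : ℝ} (hθ : 0 ≤ θ) {η₁ : ℝ} (hη : 0 ≤ η₁) {T : ℕ} (hT : 1 ≤ T) :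
    η₁ * (T : ℝ) ^ (1 - θ) ≤ ∑ j ∈ Finset.Ico 1 (T + 1), η₁ * (j : ℝ) ^ (-θ) := by
  have hT0 : (0 : ℝ) < T := by exact_mod_cast hT
  have h : (Finset.Ico 1 (T + 1)).card • (η₁ * (T : ℝ) ^ (-θ))
      ≤ ∑ j ∈ Finset.Ico 1 (T + 1), η₁ * (j : ℝ) ^ (-θ) := by
    refine Finset.card_nsmul_le_sum _ _ _ fun j hj => ?_
    obtain ⟨h3, h4⟩ := Finset.mem_Ico.mp hj
    refine mul_le_mul_of_nonneg_left ?_ hη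
    exact Real.rpow_le_rpow_of_nonpos (by exact_mod_cast h3)
      (by exact_mod_cast Nat.lt_succ_iff.mp h4) (by linarith)
  rw [Nat.card_Ico, nsmul_eq_mul, Nat.add_sub_cancel] at h
  rw [show 1 - θ = 1 + -θ by ring, Real.rpow_add hT0, Real.rpow_one]
  linarith

/-- The bias term: a total step size `S ≥ η T ^ (1 - θ)` gives
`S ^ (-p) ≤ 2 ^ (p (1 - θ)) η ^ (-p) (T + 1) ^ (-p (1 - θ))`. -/
lemma rpow_neg_le_of_le {θ p η S : ℝ} (hθ : θ ≤ 1) (hp : 0 ≤ p) (hη : 0 < η) {T : ℕ} (hT : 1 ≤ T)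
    (hS : η * (T : ℝ) ^ (1 - θ) ≤ S) :
    S ^ (-p) ≤ 2 ^ (p * (1 - θ)) * (η ^ (-p) * ((T : ℝ) + 1) ^ (-(p * (1 - θ)))) := by
  have hT0 : (0 : ℝ) < T := by exact_mod_cast hT
  calc S ^ (-p) ≤ (η * (T : ℝ) ^ (1 - θ)) ^ (-p) :=
        Real.rpow_le_rpow_of_nonpos (by positivity) hS (by linarith)
    _ = η ^ (-p) * (T : ℝ) ^ (-(p * (1 - θ))) := by
        rw [Real.mul_rpow hη.le (by positivity), ← Real.rpow_mul hT0.le]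
        congr 2; ring
    _ ≤ η ^ (-p) * (2 ^ (p * (1 - θ)) * ((T : ℝ) + 1) ^ (-(p * (1 - θ)))) := by
        gcongr
        exact rpow_neg_le_two_rpow_mul (mul_nonneg hp (by linarith)) hT
    _ = _ := by ring

end Rates

/-! ### Convergence rates -/

section ConvergenceRates

variable {𝕜 : Type*} [RCLike 𝕜] {X : Type*} [TopologicalSpace X] [PolishSpace X]
  [MeasurableSpace X] [BorelSpace X]
  {Y : Type*} [NormedAddCommGroup Y] [InnerProductSpace 𝕜 Y] [NormedSpace ℝ Y] [CompleteSpace Y]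
  [SecondCountableTopology Y] [MeasurableSpace Y] [BorelSpace Y]
  {ρ : Measure (X × Y)} [IsProbabilityMeasure ρ] {σ : ℝ}
  {K : Matrix X X (Y →L[𝕜] Y)} [Fact K.PosSemidef] {κ : ℝ}

/-- The excess risk of the iterates is integrable, and its mean is the mean square prediction
error. -/
lemma integral_excessRisk (hK : IsBoundedMercer K κ) {e : Lp Y 2 ρ.fst}
    (he : regression ρ =ᵐ[ρ.fst] e)
    (hnoise : ∫⁻ z, ‖z.2 - regression ρ z.1‖ₑ ^ 2 ∂ρ ≤ ENNReal.ofReal (σ ^ 2))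
    (η : ℕ → ℝ) (n : ℕ) :
    Integrable (fun z : ℕ → X × Y => risk ρ (iterate K η z n) - risk ρ (regression ρ))
      (Measure.infinitePi fun _ : ℕ => ρ) ∧
    ∫ z : ℕ → X × Y, (risk ρ (iterate K η z n) - risk ρ (regression ρ))
      ∂(Measure.infinitePi fun _ : ℕ => ρ) = meanSqError hK ρ e η n := by
  have h : (fun z : ℕ → X × Y => risk ρ (iterate K η z n) - risk ρ (regression ρ))
      = fun z => ‖inclusion hK ρ.fst (iterate K η z n) - e‖ ^ 2 := by
    funext z
    rw [(risk_eq hK he hnoise (iterate K η z n)).2, add_sub_cancel_right]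
  rw [h]
  exact ⟨integrable_norm_iterate_sub_sq hK he hnoise _ e η n, rfl⟩

/-- Step sizes below the threshold keep the feedback of the gradient noise below one quarter. -/
lemma mul_noiseSum_le_quarter {θ η c S : ℝ} (hθ : 0 < θ) (hη : 0 ≤ η) (hc : 0 ≤ c)
    (hsmall : η * (4 * κ ^ 2 * (1 + 2 * κ ^ 2) * c) < θ) (hS : S ≤ η * (c / θ)) :
    κ ^ 2 * (1 + κ ^ 2) * S ≤ 1 / 4 := by
  have h1 : κ ^ 2 * (1 + κ ^ 2) * S ≤ κ ^ 2 * (1 + 2 * κ ^ 2) * (η * (c / θ)) := by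
    have h2 : κ ^ 2 * (1 + κ ^ 2) ≤ κ ^ 2 * (1 + 2 * κ ^ 2) := by nlinarith [sq_nonneg (κ ^ 2)]
    have h3 : 0 ≤ η * (c / θ) := by positivity
    calc κ ^ 2 * (1 + κ ^ 2) * S ≤ κ ^ 2 * (1 + κ ^ 2) * (η * (c / θ)) := by gcongr
      _ ≤ _ := by gcongr
  refine h1.trans ?_
  rw [show κ ^ 2 * (1 + 2 * κ ^ 2) * (η * (c / θ))
    = η * (4 * κ ^ 2 * (1 + 2 * κ ^ 2) * c) / θ / 4 by ring]
  have := (div_lt_one hθ).mpr hsmall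
  linarith

lemma one_le_rpow_neg {η p : ℝ} (hη : 0 < η) (hη1 : η ≤ 1) (hp : 0 ≤ p) : 1 ≤ η ^ (-p) :=
  Real.one_le_rpow_of_pos_of_le_one_of_nonpos hη hη1 (by linarith)

/-- Convergence rate of the prediction error for decaying step sizes. -/
lemma exists_meanSqError_decaying_le (hK : IsBoundedMercer K κ)
    (hnoise : ∫⁻ z, ‖z.2 - regression ρ z.1‖ₑ ^ 2 ∂ρ ≤ ENNReal.ofReal (σ ^ 2))
    {r : ℝ} (hr : 0 < r) {g : Lp Y 2 ρ.fst}
    (he : regression ρ =ᵐ[ρ.fst] (opPow (integralOperator hK ρ.fst) r g : Lp Y 2 ρ.fst))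
    {θ : ℝ} (hθ : 0 < θ) (hθ1 : θ < 1) :
    ∃ c₁ : ℝ, ∀ η₁ : ℝ, 0 < η₁ → η₁ * ‖integralOperator hK ρ.fst‖ < 1 → η₁ < 1 - θ →
      η₁ * (4 * κ ^ 2 * (1 + 2 * κ ^ 2) * (stepSumConst θ + 1)) < θ → ∀ T : ℕ, 1 ≤ T →
        meanSqError hK ρ (opPow (integralOperator hK ρ.fst) r g)
            (fun t => η₁ * (t : ℝ) ^ (-θ)) T
          ≤ c₁ * η₁ ^ (-(2 * r)) * (if θ ≤ min (2 * r) 1 / (1 + min (2 * r) 1) then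
              ((T : ℝ) + 1) ^ (-θ) * Real.log ((T : ℝ) + 1)
            else ((T : ℝ) + 1) ^ (-(min (2 * r) 1 * (1 - θ)))) := by
  have hδ := stepSumConst_nonneg hθ1
  have hθ' : 0 < 1 - θ := by linarith
  set m := min (2 * r) 1 with hm
  have hm0 : 0 < m := lt_min (by linarith) one_pos
  have hm1 : m ≤ 1 := min_le_right _ _
  have hmr : m ≤ 2 * r := min_le_left _ _
  set A := (r ^ r * ‖g‖) ^ 2 * 2 ^ (2 * r * (1 - θ)) with hA
  set D := κ ^ 2 * (1 + κ ^ 2) *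
    (2 * ‖opPow (integralOperator hK ρ.fst) r g‖ ^ 2 + 2 * σ ^ 2) with hD
  set E := 2 + (1 + 1 / |θ - m * (1 - θ)|) with hE
  have hA0 : 0 ≤ A := by positivity
  have hD0 : 0 ≤ D := by positivity
  have hE0 : 0 ≤ E := by positivity
  refine ⟨2 * A + D * (stepSumConst θ * E + 2 ^ (2 * θ) * 2), fun η₁ hη hL hηθ hsmall T hT => ?_⟩
  have hT0 : (0 : ℝ) < T := by exact_mod_cast hT
  have hstep0 : ∀ j : ℕ, 1 ≤ j → 0 ≤ η₁ * (j : ℝ) ^ (-θ) := fun j _ => by positivity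
  have hstepL : ∀ j : ℕ, 1 ≤ j → η₁ * (j : ℝ) ^ (-θ) * ‖integralOperator hK ρ.fst‖ ≤ 1 := by
    intro j hj
    have h1 : (j : ℝ) ^ (-θ) ≤ 1 :=
      Real.rpow_le_one_of_one_le_of_nonpos (by exact_mod_cast hj) (by linarith)
    have h2 : η₁ * (j : ℝ) ^ (-θ) ≤ η₁ := mul_le_of_le_one_right hη.le h1
    exact (mul_le_mul_of_nonneg_right h2 (norm_nonneg _)).trans hL.le
  have hquarter : ∀ n ≤ T,
      κ ^ 2 * (1 + κ ^ 2) * noiseSum (fun t => η₁ * (t : ℝ) ^ (-θ)) n ≤ 1 / 4 := by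
    intro n _
    rcases Nat.eq_zero_or_pos n with rfl | hn
    · simp [noiseSum]
    refine mul_noiseSum_le_quarter hθ hη.le (by linarith : 0 ≤ stepSumConst θ + 1) hsmall
      ((noiseSum_decaying_le hθ hθ1 hη hηθ hn).trans (mul_le_mul_of_nonneg_left ?_ hη.le))
    have h1 : (n : ℝ) ^ (-(2 * θ)) ≤ 1 :=
      Real.rpow_le_one_of_one_le_of_nonpos (by exact_mod_cast hn) (by linarith)
    have h2 := mul_le_mul_of_nonneg_left (stepSumRate_le hθ hθ1 n) hδ
    have h3 : 1 ≤ 1 / θ := (one_le_div hθ).mpr hθ1.le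
    calc stepSumConst θ * stepSumRate θ n + (n : ℝ) ^ (-(2 * θ))
        ≤ stepSumConst θ * (1 / θ) + 1 / θ := by linarith
      _ = (stepSumConst θ + 1) / θ := by ring
  have hsum := mul_rpow_le_sum_Ico hθ.le hη.le hT
  have hpos : 0 < ∑ j ∈ Finset.Ico 1 (T + 1), η₁ * (j : ℝ) ^ (-θ) :=
    lt_of_lt_of_le (by positivity) hsum
  have hmain := meanSqError_le_of_source hK hr he hnoise hstep0 hstepL hquarter hpos
  have hbias := rpow_neg_le_of_le hθ1.le (by linarith : 0 ≤ 2 * r) hη hT hsum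
  have hnoiseSum := noiseSum_decaying_le hθ hθ1 hη hηθ hT
  rw [if_congr (le_div_one_add_iff hm0) rfl rfl]
  set R := if θ ≤ m * (1 - θ) then ((T : ℝ) + 1) ^ (-θ) * Real.log ((T : ℝ) + 1)
    else ((T : ℝ) + 1) ^ (-(m * (1 - θ))) with hR
  have hR1 : ((T : ℝ) + 1) ^ (-(2 * r * (1 - θ))) ≤ 2 * R :=
    rpow_neg_le_rate hT ((min_le_right _ _).trans (by gcongr))
  have hR2 : ((T : ℝ) + 1) ^ (-(2 * θ)) ≤ 2 * R :=
    rpow_neg_le_rate hT ((min_le_left _ _).trans (by linarith))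
  have hR0 : 0 ≤ R := by
    have : 0 < ((T : ℝ) + 1) ^ (-(2 * θ)) := by positivity
    linarith
  have hR3 : stepSumRate θ T ≤ E * R := by
    rw [stepSumRate]
    split_ifs with h
    · refine (rpow_neg_mul_log_le_rate θ (m * (1 - θ)) hT).trans ?_
      rw [← hR, hE]
      linarith
    · -- here `θ > 1/2`, and `1 - θ` dominates both exponents because `m ≤ 1`
      have h1 : min θ (m * (1 - θ)) ≤ 1 - θ := (min_le_right _ _).trans (by nlinarith)
      refine (rpow_neg_le_rate hT h1).trans ?_
      rw [← hR, hE]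
      have : 0 ≤ 1 / |θ - m * (1 - θ)| := by positivity
      nlinarith
  have hη1 : 1 ≤ η₁ ^ (-(2 * r)) := one_le_rpow_neg hη (by linarith) (by linarith)
  have hηpos : 0 < η₁ ^ (-(2 * r)) := by positivity
  have h4 : noiseSum (fun t => η₁ * (t : ℝ) ^ (-θ)) T
      ≤ η₁ ^ (-(2 * r)) * ((stepSumConst θ * E + 2 ^ (2 * θ) * 2) * R) := by
    have h5 : stepSumConst θ * stepSumRate θ T + (T : ℝ) ^ (-(2 * θ))
        ≤ (stepSumConst θ * E + 2 ^ (2 * θ) * 2) * R := by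
      have h6 := mul_le_mul_of_nonneg_left hR3 hδ
      have h7 := rpow_neg_le_two_rpow_mul (by linarith : 0 ≤ 2 * θ) hT
      have h8 := mul_le_mul_of_nonneg_left hR2 (by positivity : (0 : ℝ) ≤ 2 ^ (2 * θ))
      linarith
    refine hnoiseSum.trans (mul_le_mul (by linarith) h5 ?_ hηpos.le)
    have := stepSumRate_pos θ hT
    positivity
  calc meanSqError hK ρ (opPow (integralOperator hK ρ.fst) r g) (fun t => η₁ * (t : ℝ) ^ (-θ)) T
      ≤ (r ^ r * ‖g‖) ^ 2 * (2 ^ (2 * r * (1 - θ)) *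
          (η₁ ^ (-(2 * r)) * (2 * R))) + D * (η₁ ^ (-(2 * r)) *
          ((stepSumConst θ * E + 2 ^ (2 * θ) * 2) * R)) := by
        refine hmain.trans (add_le_add ?_ (mul_le_mul_of_nonneg_left h4 hD0))
        refine mul_le_mul_of_nonneg_left (hbias.trans ?_) (sq_nonneg _)
        gcongr
    _ = _ := by rw [hA]; ring

/-- The noise sum for the constant step size `η T ^ (-θ)` of the horizon `T`. -/
lemma noiseSum_horizon_le {θ η : ℝ} (hθ : 0 < θ) (hη : 0 < η) (hη1 : η < 1) {n T : ℕ}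
    (hn : n ≤ T) (hT : 1 ≤ T) :
    noiseSum (fun _ => η * (T : ℝ) ^ (-θ)) n ≤ η * ((T : ℝ) ^ (-θ) * (1 + Real.log T)) := by
  have hT1 : (1 : ℝ) ≤ T := by exact_mod_cast hT
  have h1 : (T : ℝ) ^ (-θ) ≤ 1 := Real.rpow_le_one_of_one_le_of_nonpos hT1 (by linarith)
  have h2 : η * (T : ℝ) ^ (-θ) ≤ 1 := by
    have : 0 < (T : ℝ) ^ (-θ) := by positivity
    nlinarith
  rw [← mul_assoc]
  exact noiseSum_const_le (by positivity) h2 hn hT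

lemma mul_noiseSum_horizon_le_quarter {θ η : ℝ} (hθ : 0 < θ) (hη : 0 < η) (hη1 : η < 1)
    (hsmall : η * (4 * κ ^ 2 * (1 + 2 * κ ^ 2) * (1 + 2 * θ)) < θ) {n T : ℕ} (hn : n ≤ T)
    (hT : 1 ≤ T) :
    κ ^ 2 * (1 + κ ^ 2) * noiseSum (fun _ => η * (T : ℝ) ^ (-θ)) n ≤ 1 / 4 := by
  have hT1 : (1 : ℝ) ≤ T := by exact_mod_cast hT
  refine mul_noiseSum_le_quarter hθ hη.le (by linarith : 0 ≤ 1 + 2 * θ) hsmall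
    ((noiseSum_horizon_le hθ hη hη1 hn hT).trans (mul_le_mul_of_nonneg_left ?_ hη.le))
  have h1 : (T : ℝ) ^ (-θ) ≤ 1 := Real.rpow_le_one_of_one_le_of_nonpos hT1 (by linarith)
  have h2 := rpow_neg_mul_log_le hθ (by linarith : (0 : ℝ) < T)
  calc (T : ℝ) ^ (-θ) * (1 + Real.log T) ≤ 2 + 1 / θ := by linarith
    _ = (1 + 2 * θ) / θ := by field_simp; ring

lemma mul_rpow_mul_norm_le {θ η B : ℝ} (hθ : 0 < θ) (hη : 0 < η) (hB : 0 ≤ B) (h : η * B < 1)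
    {T : ℕ} (hT : 1 ≤ T) : η * (T : ℝ) ^ (-θ) * B ≤ 1 := by
  have h1 : (T : ℝ) ^ (-θ) ≤ 1 :=
    Real.rpow_le_one_of_one_le_of_nonpos (by exact_mod_cast hT) (by linarith)
  exact (mul_le_mul_of_nonneg_right (mul_le_of_le_one_right hη.le h1) hB).trans h.le

lemma sum_Ico_horizon (θ η : ℝ) {T : ℕ} (hT : 1 ≤ T) :
    ∑ _j ∈ Finset.Ico 1 (T + 1), η * (T : ℝ) ^ (-θ) = η * (T : ℝ) ^ (1 - θ) := by
  have hT0 : (0 : ℝ) < T := by exact_mod_cast hT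
  rw [Finset.sum_const, Nat.card_Ico, nsmul_eq_mul, Nat.add_sub_cancel,
    show 1 - θ = 1 + -θ by ring, Real.rpow_add hT0, Real.rpow_one]
  ring

/-- Convergence rate of the prediction error for horizon-dependent constant step sizes. -/
lemma exists_meanSqError_horizon_le (hK : IsBoundedMercer K κ)
    (hnoise : ∫⁻ z, ‖z.2 - regression ρ z.1‖ₑ ^ 2 ∂ρ ≤ ENNReal.ofReal (σ ^ 2))
    {r : ℝ} (hr : 0 < r) {g : Lp Y 2 ρ.fst}
    (he : regression ρ =ᵐ[ρ.fst] (opPow (integralOperator hK ρ.fst) r g : Lp Y 2 ρ.fst))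
    {θ : ℝ} (hθ : 0 < θ) (hθ1 : θ < 1) :
    ∃ c₁ : ℝ, ∀ η : ℝ, 0 < η → η * ‖integralOperator hK ρ.fst‖ < 1 → η < 1 →
      η * (4 * κ ^ 2 * (1 + 2 * κ ^ 2) * (1 + 2 * θ)) < θ → ∀ T : ℕ, 1 ≤ T →
        meanSqError hK ρ (opPow (integralOperator hK ρ.fst) r g)
            (fun _ => η * (T : ℝ) ^ (-θ)) T
          ≤ c₁ * η ^ (-(2 * r)) * (if θ ≤ 2 * r / (1 + 2 * r) then
              ((T : ℝ) + 1) ^ (-θ) * Real.log ((T : ℝ) + 1)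
            else ((T : ℝ) + 1) ^ (-(2 * r * (1 - θ)))) := by
  have hθ' : 0 < 1 - θ := by linarith
  set A := (r ^ r * ‖g‖) ^ 2 * 2 ^ (2 * r * (1 - θ)) with hA
  set D := κ ^ 2 * (1 + κ ^ 2) *
    (2 * ‖opPow (integralOperator hK ρ.fst) r g‖ ^ 2 + 2 * σ ^ 2) with hD
  set E := 1 + 1 / |θ - 2 * r * (1 - θ)| with hE
  have hA0 : 0 ≤ A := by positivity
  have hD0 : 0 ≤ D := by positivity
  have hE0 : 0 ≤ E := by positivity
  refine ⟨2 * A + D * (2 ^ θ * 3 * E), fun η hη hL hη1 hsmall T hT => ?_⟩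
  have hT0 : (0 : ℝ) < T := by exact_mod_cast hT
  have hsum := sum_Ico_horizon θ η hT
  have hmain := meanSqError_le_of_source hK hr he hnoise (η := fun _ => η * (T : ℝ) ^ (-θ))
    (T := T) (fun j _ => by positivity)
    (fun j _ => mul_rpow_mul_norm_le hθ hη (norm_nonneg _) hL hT)
    (fun n hn => mul_noiseSum_horizon_le_quarter hθ hη hη1 hsmall hn hT)
    (by rw [hsum]; positivity)
  have hbias := rpow_neg_le_of_le hθ1.le (by linarith : 0 ≤ 2 * r) hη hT hsum.ge
  have hnoiseSum := noiseSum_horizon_le hθ hη hη1 le_rfl hT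
  rw [if_congr (le_div_one_add_iff (by linarith : 0 < 2 * r)) rfl rfl]
  set R := if θ ≤ 2 * r * (1 - θ) then ((T : ℝ) + 1) ^ (-θ) * Real.log ((T : ℝ) + 1)
    else ((T : ℝ) + 1) ^ (-(2 * r * (1 - θ))) with hR
  have hR1 : ((T : ℝ) + 1) ^ (-(2 * r * (1 - θ))) ≤ 2 * R :=
    rpow_neg_le_rate hT (min_le_right _ _)
  have hR3 : ((T : ℝ) + 1) ^ (-θ) * Real.log ((T : ℝ) + 1) ≤ E * R :=
    rpow_neg_mul_log_le_rate θ (2 * r * (1 - θ)) hT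
  have hη2 : 1 ≤ η ^ (-(2 * r)) := one_le_rpow_neg hη hη1.le (by linarith)
  have hηpos : 0 < η ^ (-(2 * r)) := by positivity
  have h4 : noiseSum (fun _ => η * (T : ℝ) ^ (-θ)) T
      ≤ η ^ (-(2 * r)) * (2 ^ θ * 3 * E * R) := by
    have hlog : 0 ≤ 1 + Real.log T := by
      have := Real.log_nonneg (by exact_mod_cast hT : (1 : ℝ) ≤ T)
      linarith
    refine hnoiseSum.trans (mul_le_mul (by linarith) ?_ (by positivity) hηpos.le)
    calc (T : ℝ) ^ (-θ) * (1 + Real.log T)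
        ≤ (2 ^ θ * ((T : ℝ) + 1) ^ (-θ)) * (3 * Real.log ((T : ℝ) + 1)) :=
          mul_le_mul (rpow_neg_le_two_rpow_mul hθ.le hT) (one_add_log_le hT) hlog (by positivity)
      _ = 2 ^ θ * 3 * (((T : ℝ) + 1) ^ (-θ) * Real.log ((T : ℝ) + 1)) := by ring
      _ ≤ 2 ^ θ * 3 * (E * R) := by gcongr
      _ = 2 ^ θ * 3 * E * R := by ring
  calc meanSqError hK ρ (opPow (integralOperator hK ρ.fst) r g) (fun _ => η * (T : ℝ) ^ (-θ)) T
      ≤ (r ^ r * ‖g‖) ^ 2 * (2 ^ (2 * r * (1 - θ)) *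
          (η ^ (-(2 * r)) * (2 * R))) + D * (η ^ (-(2 * r)) * (2 ^ θ * 3 * E * R)) := by
        refine hmain.trans (add_le_add ?_ (mul_le_mul_of_nonneg_left h4 hD0))
        refine mul_le_mul_of_nonneg_left (hbias.trans ?_) (sq_nonneg _)
        gcongr
    _ = _ := by rw [hA]; ring

/-- Convergence rate of the estimation error in the reproducing kernel Hilbert space. -/
lemma exists_integral_norm_sub_sq_horizon_le (hK : IsBoundedMercer K κ)
    (hnoise : ∫⁻ z, ‖z.2 - regression ρ z.1‖ₑ ^ 2 ∂ρ ≤ ENNReal.ofReal (σ ^ 2))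
    {r : ℝ} (hr : 1 / 2 < r) {g : Lp Y 2 ρ.fst}
    (he : regression ρ =ᵐ[ρ.fst] (opPow (integralOperator hK ρ.fst) r g : Lp Y 2 ρ.fst))
    {θ : ℝ} (hθ : 0 < θ) (hθ1 : θ < 1) :
    ∃ c₁ : ℝ, ∃ u : RKHS.OfKernel K, (u : X → Y) =ᵐ[ρ.fst] regression ρ ∧
      ∀ η : ℝ, 0 < η → η * ‖integralOperator hK ρ.fst‖ < 1 → η < 1 →
      η * (4 * κ ^ 2 * (1 + 2 * κ ^ 2) * (1 + 2 * θ)) < θ → ∀ T : ℕ, 1 ≤ T →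
        Integrable (fun z : ℕ → X × Y => ‖iterate K (fun _ => η * (T : ℝ) ^ (-θ)) z T - u‖ ^ 2)
          (Measure.infinitePi fun _ : ℕ => ρ) ∧
        ∫ z : ℕ → X × Y, ‖iterate K (fun _ => η * (T : ℝ) ^ (-θ)) z T - u‖ ^ 2
            ∂(Measure.infinitePi fun _ : ℕ => ρ)
          ≤ c₁ * η ^ (-(2 * r - 1)) *
              (if θ ≤ 2 * r / (2 * r + 1) then ((T : ℝ) + 1) ^ (1 - 2 * θ)
                else ((T : ℝ) + 1) ^ (-((2 * r - 1) * (1 - θ)))) := by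
  obtain ⟨u, hu, hbound⟩ := exists_integral_norm_iterate_sub_sq_le hK hr he hnoise
  have hθ' : 0 < 1 - θ := by linarith
  set A := ((r - 1 / 2) ^ (r - 1 / 2) * ‖g‖) ^ 2 with hA
  set D := κ ^ 2 * (2 * ‖opPow (integralOperator hK ρ.fst) r g‖ ^ 2 + 2 * σ ^ 2) with hD
  have hA0 : 0 ≤ A := by positivity
  have hD0 : 0 ≤ D := by positivity
  refine ⟨A * 2 ^ ((2 * r - 1) * (1 - θ)) + D * 4, u, hu, fun η hη hL hη1 hsmall T hT => ?_⟩
  have hT0 : (0 : ℝ) < T := by exact_mod_cast hT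
  have hN : (1 : ℝ) ≤ (T : ℝ) + 1 := by linarith
  have hsum := sum_Ico_horizon θ η hT
  obtain ⟨hint, hmain⟩ := hbound (η := fun _ => η * (T : ℝ) ^ (-θ)) (T := T)
    (fun j _ => by positivity)
    (fun j _ => mul_rpow_mul_norm_le hθ hη (norm_nonneg _) hL hT)
    (fun n hn => mul_noiseSum_horizon_le_quarter hθ hη hη1 hsmall hn hT)
    (by rw [hsum]; positivity)
  refine ⟨hint, hmain.trans ?_⟩
  have hbias := rpow_neg_le_of_le hθ1.le (by linarith : 0 ≤ 2 * r - 1) hη hT hsum.ge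
  have hη2 : 1 ≤ η ^ (-(2 * r - 1)) := one_le_rpow_neg hη hη1.le (by linarith)
  have hiff : θ ≤ 2 * r / (2 * r + 1) ↔ θ ≤ 2 * r * (1 - θ) := by
    rw [add_comm (2 * r) 1]
    exact le_div_one_add_iff (by linarith)
  rw [if_congr hiff rfl rfl]
  set R := if θ ≤ 2 * r * (1 - θ) then ((T : ℝ) + 1) ^ (1 - 2 * θ)
    else ((T : ℝ) + 1) ^ (-((2 * r - 1) * (1 - θ))) with hR
  have hR1 : ((T : ℝ) + 1) ^ (-((2 * r - 1) * (1 - θ))) ≤ R := by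
    rw [hR]
    split_ifs with h
    · exact Real.rpow_le_rpow_of_exponent_le hN (by linarith)
    · exact le_rfl
  have hR2 : ((T : ℝ) + 1) ^ (1 - 2 * θ) ≤ R := by
    rw [hR]
    split_ifs with h
    · exact le_rfl
    · exact Real.rpow_le_rpow_of_exponent_le hN (by linarith [not_le.mp h])
  have hsq : ∑ _j ∈ Finset.Ico 1 (T + 1), (η * (T : ℝ) ^ (-θ)) ^ 2
      ≤ η ^ (-(2 * r - 1)) * (4 * R) := by
    have e1 : ∑ _j ∈ Finset.Ico 1 (T + 1), (η * (T : ℝ) ^ (-θ)) ^ 2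
        = η ^ 2 * (T * (T : ℝ) ^ (-(2 * θ))) := by
      rw [Finset.sum_const, Nat.card_Ico, nsmul_eq_mul, Nat.add_sub_cancel, mul_pow,
        ← Real.rpow_mul_natCast hT0.le, show -θ * (2 : ℕ) = -(2 * θ) by push_cast; ring]
      ring
    have h4 : (2 : ℝ) ^ (2 * θ) ≤ 4 := by
      calc (2 : ℝ) ^ (2 * θ) ≤ 2 ^ (2 : ℝ) :=
            Real.rpow_le_rpow_of_exponent_le (by norm_num) (by linarith)
        _ = 4 := by norm_num
    have h5 : (T : ℝ) * (T : ℝ) ^ (-(2 * θ)) ≤ 4 * R := by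
      calc (T : ℝ) * (T : ℝ) ^ (-(2 * θ))
          ≤ ((T : ℝ) + 1) * (2 ^ (2 * θ) * ((T : ℝ) + 1) ^ (-(2 * θ))) :=
            mul_le_mul (by linarith) (rpow_neg_le_two_rpow_mul (by linarith) hT) (by positivity)
              (by positivity)
        _ = 2 ^ (2 * θ) * ((T : ℝ) + 1) ^ (1 - 2 * θ) := by
            rw [show 1 - 2 * θ = 1 + -(2 * θ) by ring, Real.rpow_add (by positivity),
              Real.rpow_one]
            ring
        _ ≤ 4 * R := mul_le_mul h4 hR2 (by positivity) (by norm_num)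
    rw [e1]
    refine mul_le_mul ?_ h5 (by positivity) (by positivity)
    exact (pow_le_one₀ hη.le hη1.le).trans hη2
  calc _ ≤ A * (2 ^ ((2 * r - 1) * (1 - θ)) * (η ^ (-(2 * r - 1)) * R))
        + D * (η ^ (-(2 * r - 1)) * (4 * R)) := by
        refine add_le_add (mul_le_mul_of_nonneg_left (hbias.trans ?_) hA0)
          (mul_le_mul_of_nonneg_left hsq hD0)
        gcongr
    _ = _ := by ring

end ConvergenceRates

end KernelSGD

end

theorem theorem1 {𝕜 : Type*} [RCLike 𝕜]
    {X : Type*} [TopologicalSpace X] [PolishSpace X] [MeasurableSpace X] [BorelSpace X]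
    {Y : Type*} [NormedAddCommGroup Y] [InnerProductSpace 𝕜 Y] [NormedSpace ℝ Y] [CompleteSpace Y]
    [SecondCountableTopology Y] [MeasurableSpace Y] [BorelSpace Y]
    -- the law of the observations `(x, y)`; its marginal on `X` has full support
    (ρ : Measure (X × Y)) [IsProbabilityMeasure ρ] [ρ.fst.IsOpenPosMeasure]
    -- a bounded Mercer operator-valued kernel
    (K : Matrix X X (Y →L[𝕜] Y)) [Fact K.PosSemidef]
    (κ : ℝ) (hK : KernelSGD.IsBoundedMercer K κ)
    -- the noise has finite variance
    (σ : ℝ) (hσ : 0 < σ)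
    (hnoise : ∫⁻ z, ‖z.2 - KernelSGD.regression ρ z.1‖ₑ ^ 2 ∂ρ ≤ ENNReal.ofReal (σ ^ 2))
    -- the source condition `h† = L_K ^ r g†`
    (r : ℝ) (hr : 0 < r) (g : Lp Y 2 ρ.fst)
    (hsource : KernelSGD.regression ρ =ᵐ[ρ.fst]
      (KernelSGD.opPow (KernelSGD.integralOperator hK ρ.fst) r g : Lp Y 2 ρ.fst)) :
    -- (1) decaying step sizes `η_t = η₁ t ^ (-θ)`
    (∀ θ : ℝ, 0 < θ → θ < 1 → ∃ c₁ : ℝ, ∀ η₁ : ℝ, 0 < η₁ →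
      η₁ * ‖KernelSGD.integralOperator hK ρ.fst‖ < 1 →
      η₁ < 1 - θ →
      η₁ * (4 * κ ^ 2 * (1 + 2 * κ ^ 2) * (KernelSGD.stepSumConst θ + 1)) < θ →
      ∀ T : ℕ, 1 ≤ T →
        Integrable (fun z : ℕ → X × Y =>
          KernelSGD.risk ρ (KernelSGD.iterate K (fun t => η₁ * (t : ℝ) ^ (-θ)) z T) -
            KernelSGD.risk ρ (KernelSGD.regression ρ)) (Measure.infinitePi fun _ : ℕ => ρ) ∧
        ∫ z : ℕ → X × Y,
          (KernelSGD.risk ρ (KernelSGD.iterate K (fun t => η₁ * (t : ℝ) ^ (-θ)) z T) -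
            KernelSGD.risk ρ (KernelSGD.regression ρ)) ∂(Measure.infinitePi fun _ : ℕ => ρ) ≤
          c₁ * η₁ ^ (-(2 * r)) *
            (if θ ≤ min (2 * r) 1 / (1 + min (2 * r) 1) then
              ((T : ℝ) + 1) ^ (-θ) * Real.log ((T : ℝ) + 1)
            else ((T : ℝ) + 1) ^ (-(min (2 * r) 1 * (1 - θ))))) ∧
    -- (2) constant step sizes `η_t = η T ^ (-θ')` for the horizon `T`
    (∀ θ' : ℝ, 0 < θ' → θ' < 1 → ∃ c₁' : ℝ, ∀ η : ℝ, 0 < η →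
      η * ‖KernelSGD.integralOperator hK ρ.fst‖ < 1 →
      η < 1 →
      η * (4 * κ ^ 2 * (1 + 2 * κ ^ 2) * (1 + 2 * θ')) < θ' →
      ∀ T : ℕ, 1 ≤ T →
        -- prediction error
        (Integrable (fun z : ℕ → X × Y =>
          KernelSGD.risk ρ (KernelSGD.iterate K (fun _ => η * (T : ℝ) ^ (-θ')) z T) -
            KernelSGD.risk ρ (KernelSGD.regression ρ)) (Measure.infinitePi fun _ : ℕ => ρ) ∧
        ∫ z : ℕ → X × Y,
          (KernelSGD.risk ρ (KernelSGD.iterate K (fun _ => η * (T : ℝ) ^ (-θ')) z T) -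
            KernelSGD.risk ρ (KernelSGD.regression ρ)) ∂(Measure.infinitePi fun _ : ℕ => ρ) ≤
          c₁' * η ^ (-(2 * r)) *
            (if θ' ≤ 2 * r / (1 + 2 * r) then
              ((T : ℝ) + 1) ^ (-θ') * Real.log ((T : ℝ) + 1)
            else ((T : ℝ) + 1) ^ (-(2 * r * (1 - θ'))))) ∧
        -- estimation error; `u` is the (unique) element of the RKHS that represents `h†`
        (1 / 2 < r → 1 / 2 < θ' →
          ∃ u : RKHS.OfKernel K, (u : X → Y) =ᵐ[ρ.fst] KernelSGD.regression ρ ∧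
            Integrable (fun z : ℕ → X × Y =>
              ‖KernelSGD.iterate K (fun _ => η * (T : ℝ) ^ (-θ')) z T - u‖ ^ 2)
              (Measure.infinitePi fun _ : ℕ => ρ) ∧
            ∫ z : ℕ → X × Y,
              ‖KernelSGD.iterate K (fun _ => η * (T : ℝ) ^ (-θ')) z T - u‖ ^ 2
                ∂(Measure.infinitePi fun _ : ℕ => ρ) ≤
              c₁' * η ^ (-(2 * r - 1)) *
                (if θ' ≤ 2 * r / (2 * r + 1) then ((T : ℝ) + 1) ^ (1 - 2 * θ')
                else ((T : ℝ) + 1) ^ (-((2 * r - 1) * (1 - θ')))))) := by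
  have he : KernelSGD.regression ρ =ᵐ[ρ.fst]
    (KernelSGD.opPow (KernelSGD.integralOperator hK ρ.fst) r g : Lp Y 2 ρ.fst) := hsource
  refine ⟨fun θ hθ hθ1 => ?_, fun θ hθ hθ1 => ?_⟩
  · obtain ⟨c, hc⟩ := KernelSGD.exists_meanSqError_decaying_le hK hnoise hr he hθ hθ1
    refine ⟨c, fun η hη hL hη1 hsmall T hT => ?_⟩
    obtain ⟨hi, hint⟩ := KernelSGD.integral_excessRisk hK he hnoise
      (fun t => η * (t : ℝ) ^ (-θ)) T
    exact ⟨hi, hint.trans_le (hc η hη hL hη1 hsmall T hT)⟩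
  · obtain ⟨c, hc⟩ := KernelSGD.exists_meanSqError_horizon_le hK hnoise hr he hθ hθ1
    -- the constant for the RKHS error exists only if `r > 1 / 2`
    have hc' : ∃ c' : ℝ, 1 / 2 < r → ∃ u : RKHS.OfKernel K,
        (u : X → Y) =ᵐ[ρ.fst] KernelSGD.regression ρ ∧
        ∀ η : ℝ, 0 < η → η * ‖KernelSGD.integralOperator hK ρ.fst‖ < 1 → η < 1 →
        η * (4 * κ ^ 2 * (1 + 2 * κ ^ 2) * (1 + 2 * θ)) < θ → ∀ T : ℕ, 1 ≤ T →
          Integrable (fun z : ℕ → X × Y =>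
            ‖KernelSGD.iterate K (fun _ => η * (T : ℝ) ^ (-θ)) z T - u‖ ^ 2)
            (Measure.infinitePi fun _ : ℕ => ρ) ∧
          ∫ z : ℕ → X × Y, ‖KernelSGD.iterate K (fun _ => η * (T : ℝ) ^ (-θ)) z T - u‖ ^ 2
              ∂(Measure.infinitePi fun _ : ℕ => ρ)
            ≤ c' * η ^ (-(2 * r - 1)) *
                (if θ ≤ 2 * r / (2 * r + 1) then ((T : ℝ) + 1) ^ (1 - 2 * θ)
                  else ((T : ℝ) + 1) ^ (-((2 * r - 1) * (1 - θ)))) := by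
      by_cases h : 1 / 2 < r
      · obtain ⟨c', hc'⟩ := KernelSGD.exists_integral_norm_sub_sq_horizon_le hK hnoise h he hθ hθ1
        exact ⟨c', fun _ => hc'⟩
      · exact ⟨0, fun h' => absurd h' h⟩
    obtain ⟨c', hc'⟩ := hc'
    refine ⟨max c c', fun η hη hL hη1 hsmall T hT => ⟨?_, fun hr2 _ => ?_⟩⟩
    · obtain ⟨hi, hint⟩ := KernelSGD.integral_excessRisk hK he hnoise
        (fun _ => η * (T : ℝ) ^ (-θ)) T
      refine ⟨hi, (hint.trans_le (hc η hη hL hη1 hsmall T hT)).trans ?_⟩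
      have hlog : 0 ≤ Real.log ((T : ℝ) + 1) := by linarith [KernelSGD.one_le_two_mul_log hT]
      refine mul_le_mul_of_nonneg_right (mul_le_mul_of_nonneg_right (le_max_left c c') ?_) ?_
      · positivity
      · split_ifs <;> positivity
    · obtain ⟨u, hu, hbound⟩ := hc' hr2
      obtain ⟨hi, hint⟩ := hbound η hη hL hη1 hsmall T hT
      refine ⟨u, hu, hi, hint.trans ?_⟩
      refine mul_le_mul_of_nonneg_right (mul_le_mul_of_nonneg_right (le_max_right c c') ?_) ?_
      · positivity
      · split_ifs <;> positivity
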